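/- Let $R$ be a regular local ring of dimension two with maximal ideal $\mathfrak m_R$, residue field $\mathfrak k=R/\mathfrak m_R$ and quotient field $K$, and let $x,y$ be regular parameters in $R$ (that is, $\mathfrak m_R=(x,y)$). Let $CS\subset R$ be a coefficient set: a subset containing $0$ and $1$ which maps bijectively onto $\mathfrak k$ under the residue map. Let $\nu$ be a valuation of $K$ (with values in a totally ordered abelian group, written additively) whose valuation ring $V_\nu$ dominates $R$, i.e. $R\subset V_\nu$ and $\mathfrak m_\nu\cap R=\mathfrak m_R$. Let $L=V_\nu/\mathfrak m_\nu$, regarded as an extension field of $\mathfrak k$, and for $f\in V_\nu$ let $[f]$ be its class in $L$. For elements $g_1,\dots,g_s$ of the value group, $G(g_1,\dots,g_s)$ is the subgroup that they generate. Then there exist $\Omega\in\{1,2,3,\dots\}\cup\{\infty\}$ and elements $P_i\in\mathfrak m_R$ for all integers $i\ge 0$ with $i\le\Omega$ such that $P_0=x$, $P_1=y$, and for $1\le i<\Omega$ there is an expression $$P_{i+1}=P_i^{n_i}+\sum_{k=1}^{\lambda_i}c_k\,P_0^{\sigma_{i,0}(k)}P_1^{\sigma_{i,1}(k)}\cdots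 P_i^{\sigma_{i,i}(k)}$$ with $n_i\ge 1$, $\lambda_i\ge 1$, $0\ne c_k\in CS$ (the $c_k$ depending also on $i$), $\sigma_{i,s}(k)\in\mathbb N$, $0\le\sigma_{i,s}(k)<n_s$ for $1\le s\le i$, and $$n_i\nu(P_i)=\nu\bigl(P_0^{\sigma_{i,0}(k)}\cdots P_i^{\sigma_{i,i}(k)}\bigr)\quad\text{for all }k,$$ and such that the following hold. 1. $\nu(P_{i+1})>n_i\nu(P_i)$ for $1\le i<\Omega$. 2. Let $r\in\mathbb N$ with $r\le\Omega$, let $m\ge 1$, and let $(j_0(l),\dots,j_r(l))\in\mathbb N^{r+1}$, $1\le l\le m$, be distinct, with $j_k(l)<n_k$ for all $k$ with $1\le k\le r$ and $k<\Omega$ (no bound is imposed on the exponent of $P_\Omega$). Suppose that the monomials $M_l=P_0^{j_0(l)}\cdots P_r^{j_r(l)}$ all have the same value $\nu(M_l)=\nu(M_1)$. Then $1,[M_2/M_1],\dots,[M_m/M_1]$ are linearly independent over $\mathfrak k$. 3. For $1\le i\le\Omega$, $i<\infty$, let $\overline n_i=[G(\nu(P_0),\dots,\nu(P_i)):G(\nu(P_0),\dots,\nu(P_{i-1}))]\in\{1,2,\dots\}\cup\{\infty\}$.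 For $1\le i<\Omega$, $\overline n_i$ is finite and divides $\sigma_{i,i}(k)$ for all $k$, and $n_i=\overline n_id_i$ with $d_i$ a positive integer, where $d_i$ is the degree defined in 4. 4. For $1\le i\le\Omega$, $i<\infty$, with $\overline n_i<\infty$ there is $U_i=P_0^{w_0(i)}P_1^{w_1(i)}\cdots P_{i-1}^{w_{i-1}(i)}$ with $w_j(i)\in\mathbb N$ and $w_j(i)<n_j$ for $1\le j\le i-1$, such that $\nu(P_i^{\overline n_i})=\nu(U_i)$. Put $\alpha_i=[P_i^{\overline n_i}/U_i]$ (and $\alpha_i=1$ if $\overline n_i=\infty$), and $d_i=[\mathfrak k(\alpha_1,\dots,\alpha_i):\mathfrak k(\alpha_1,\dots,\alpha_{i-1})]$. For $1\le i<\Omega$ and $0\le t\le d_i-1$, $$b_{i,t}=\left[\sum_{\sigma_{i,i}(k)=t\overline n_i}c_k\frac{P_0^{\sigma_{i,0}(k)}\cdots P_{i-1}^{\sigma_{i,i-1}(k)}}{U_i^{d_i-t}}\right]\in\mathfrak k(\alpha_1,\dots,\alpha_{i-1}),$$ and $f_i(u)=u^{d_i}+b_{i,d_i-1}u^{d_i-1}+\cdots+b_{i,0}$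 is the minimal polynomial of $\alpha_i$ over $\mathfrak k(\alpha_1,\dots,\alpha_{i-1})$. 5. The sequence ends exactly where $\overline n_i$ or $d_i$ is infinite: for every integer $i$ with $1\le i\le\Omega$, one has $i=\Omega$ if and only if either $\overline n_i=\infty$, or $\overline n_i<\infty$ and $d_i=[\mathfrak k(\alpha_1,\dots,\alpha_i):\mathfrak k(\alpha_1,\dots,\alpha_{i-1})]=\infty$. -/

import Mathlib

noncomputable section

namespace KeyPoly

/-- The valuation ring `V_ν` of an additive valuation `ν` of a field `K`:
the elements of nonnegative value. -/
def valRing {K Γ : Type*} [Field K] [AddCommGroup Γ] [LinearOrder Γ] [IsOrderedAddMonoid Γ]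
    (ν : AddValuation K (WithTop Γ)) : ValuationSubring K where
  carrier := {f | 0 ≤ ν f}
  mul_mem' := by
    intro a b ha hb
    simp only [Set.mem_ofPred_eq] at ha hb ⊢
    rw [ν.map_mul]
    exact add_nonneg ha hb
  one_mem' := by simp
  add_mem' := by
    intro a b ha hb
    exact ν.map_le_add ha hb
  zero_mem' := by simp
  neg_mem' := by
    intro a ha
    simpa using ha
  mem_or_inv_mem' := by
    intro a
    by_cases h0 : a = 0
    · left
      simp [h0]
    · rcases le_total 0 (ν a) with h | h
      · exact Or.inl h
      · right
        have h1 : ν a + ν a⁻¹ = 0 := by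
          rw [← ν.map_mul, mul_inv_cancel₀ h0, ν.map_one]
        change 0 ≤ ν a⁻¹
        calc (0 : WithTop Γ) = ν a + ν a⁻¹ := h1.symm
          _ ≤ 0 + ν a⁻¹ := by gcongr
          _ = ν a⁻¹ := zero_add _

/-- The residue field `L = V_ν / m_ν`. -/
abbrev ResField {K Γ : Type*} [Field K] [AddCommGroup Γ] [LinearOrder Γ] [IsOrderedAddMonoid Γ]
    (ν : AddValuation K (WithTop Γ)) : Type _ :=
  IsLocalRing.ResidueField (valRing ν)

open Classical in
/-- The class `[f] ∈ L` of an element `f ∈ V_ν` (and the dummy value `0` for `f ∉ V_ν`). -/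
def res {K Γ : Type*} [Field K] [AddCommGroup Γ] [LinearOrder Γ] [IsOrderedAddMonoid Γ]
    (ν : AddValuation K (WithTop Γ)) (f : K) : ResField ν :=
  if h : f ∈ valRing ν then IsLocalRing.residue (valRing ν) ⟨f, h⟩ else 0

/-- `ν` dominates the local ring `R`: `R ⊆ V_ν` and `m_ν ∩ R = m_R`. -/
structure Dominates (R : Type*) {K Γ : Type*} [CommRing R] [IsLocalRing R] [Field K] [Algebra R K]
    [AddCommGroup Γ] [LinearOrder Γ] [IsOrderedAddMonoid Γ]
    (ν : AddValuation K (WithTop Γ)) : Prop where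
  nonneg : ∀ f : R, 0 ≤ ν (algebraMap R K f)
  pos_iff : ∀ f : R, 0 < ν (algebraMap R K f) ↔ f ∈ IsLocalRing.maximalIdeal R

section

variable {R K Γ : Type*} [CommRing R] [IsLocalRing R] [Field K] [Algebra R K]
  [AddCommGroup Γ] [LinearOrder Γ] [IsOrderedAddMonoid Γ] {ν : AddValuation K (WithTop Γ)}

/-- The inclusion `R → V_ν`. -/
def toValRing (h : Dominates R ν) : R →+* valRing ν :=
  (algebraMap R K).codRestrict (valRing ν).toSubring h.nonneg

theorem isLocalHom_toValRing (h : Dominates R ν) : IsLocalHom (toValRing h) := by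
  refine ⟨fun a ha => ?_⟩
  by_contra hn
  have h1 : 0 < ν (algebraMap R K a) := (h.pos_iff a).2 hn
  obtain ⟨b, hb⟩ := ha.exists_right_inv
  have h2 : algebraMap R K a * (b : K) = 1 := congrArg Subtype.val hb
  have h3 : ν (algebraMap R K a) + ν (b : K) = 0 := by
    rw [← ν.map_mul, h2, ν.map_one]
  have h4 : 0 ≤ ν (b : K) := b.2
  exact absurd h3 (add_pos_of_pos_of_nonneg h1 h4).ne'

/-- The induced embedding `k = R / m_R → L = V_ν / m_ν` of residue fields. -/
def residueMap (h : Dominates R ν) : IsLocalRing.ResidueField R →+* ResField ν :=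
  haveI := isLocalHom_toValRing h
  IsLocalRing.ResidueField.map (toValRing h)

/-- The field `k = R / m_R`, regarded as a subfield of `L`. -/
def baseField (h : Dominates R ν) : Subfield (ResField ν) :=
  (residueMap h).fieldRange

end

/-- The monomial `P_0^{e_0} P_1^{e_1} ⋯ P_{r-1}^{e_{r-1}}` in the first `r` terms of `P`. -/
def mono {R : Type*} [CommRing R] (P : ℕ → R) (e : ℕ → ℕ) (r : ℕ) : R :=
  ∏ s ∈ Finset.range r, P s ^ e s

/-- The subgroup `G(ν(P_0), …, ν(P_{m-1}))` of the value group. -/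
def valGroup {R K Γ : Type*} [CommRing R] [Field K] [Algebra R K]
    [AddCommGroup Γ] [LinearOrder Γ] [IsOrderedAddMonoid Γ]
    (ν : AddValuation K (WithTop Γ)) (P : ℕ → R) (m : ℕ) : AddSubgroup Γ :=
  AddSubgroup.closure {γ | ∃ j < m, ν (algebraMap R K (P j)) = (γ : WithTop Γ)}

/-- `n̄_i = [G(ν(P_0), …, ν(P_i)) : G(ν(P_0), …, ν(P_{i-1}))]`; as always for indices in
Mathlib, the value `0` encodes that the index is infinite. -/
def nbar {R K Γ : Type*} [CommRing R] [Field K] [Algebra R K]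
    [AddCommGroup Γ] [LinearOrder Γ] [IsOrderedAddMonoid Γ]
    (ν : AddValuation K (WithTop Γ)) (P : ℕ → R) (i : ℕ) : ℕ :=
  (valGroup ν P i).relIndex (valGroup ν P (i + 1))

/-- `α_i = [P_i^{n̄_i} / U_i]` where `U_i = P_0^{w_0(i)} ⋯ P_{i-1}^{w_{i-1}(i)}`, and `α_i = 1`
if `n̄_i = ∞`. -/
def alpha {R K Γ : Type*} [CommRing R] [Field K] [Algebra R K]
    [AddCommGroup Γ] [LinearOrder Γ] [IsOrderedAddMonoid Γ]
    (ν : AddValuation K (WithTop Γ)) (P : ℕ → R) (w : ℕ → ℕ → ℕ) (i : ℕ) : ResField ν :=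
  if nbar ν P i = 0 then 1
  else res ν (algebraMap R K (P i) ^ nbar ν P i / algebraMap R K (mono P (w i) i))

/-- The subfield `k(α_1, …, α_{m-1})` of `L`. -/
def adjField {R K Γ : Type*} [CommRing R] [IsLocalRing R] [Field K] [Algebra R K]
    [AddCommGroup Γ] [LinearOrder Γ] [IsOrderedAddMonoid Γ] {ν : AddValuation K (WithTop Γ)}
    (h : Dominates R ν) (P : ℕ → R) (w : ℕ → ℕ → ℕ) (m : ℕ) : Subfield (ResField ν) :=
  Subfield.closure ((baseField h : Set (ResField ν)) ∪ {a | ∃ j, 1 ≤ j ∧ j < m ∧ a = alpha ν P w j})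

/-- `d_i = [k(α_1, …, α_i) : k(α_1, …, α_{i-1})]`; as always for field degrees in
Mathlib, the value `0` encodes that the degree is infinite. -/
def deg {R K Γ : Type*} [CommRing R] [IsLocalRing R] [Field K] [Algebra R K]
    [AddCommGroup Γ] [LinearOrder Γ] [IsOrderedAddMonoid Γ] {ν : AddValuation K (WithTop Γ)}
    (h : Dominates R ν) (P : ℕ → R) (w : ℕ → ℕ → ℕ) (i : ℕ) : ℕ :=
  Subfield.relfinrank (adjField h P w i) (adjField h P w (i + 1))

/-- `b_{i,t} = [∑ c_k P_0^{σ_{i,0}(k)} ⋯ P_{i-1}^{σ_{i,i-1}(k)} / U_i^{d_i - t}]`, the sum being over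
those `1 ≤ k ≤ λ_i` with `σ_{i,i}(k) = t n̄_i`. Here `c i k` is the coefficient `c_k` of the expression
of `P_{i+1}`, and `σ i k s` is the exponent `σ_{i,s}(k)`. -/
def bcoef {R K Γ : Type*} [CommRing R] [IsLocalRing R] [Field K] [Algebra R K]
    [AddCommGroup Γ] [LinearOrder Γ] [IsOrderedAddMonoid Γ] {ν : AddValuation K (WithTop Γ)}
    (h : Dominates R ν) (P : ℕ → R) (lam : ℕ → ℕ) (c : ℕ → ℕ → R) (σ : ℕ → ℕ → ℕ → ℕ)
    (w : ℕ → ℕ → ℕ) (i t : ℕ) : ResField ν :=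
  res ν (∑ k ∈ Finset.Icc 1 (lam i) with σ i k i = t * nbar ν P i,
    algebraMap R K (c i k) *
      (algebraMap R K (mono P (σ i k) i) / algebraMap R K (mono P (w i) i) ^ (deg h P w i - t)))

/-- A coefficient set of a local ring `R`: a set of representatives of the residue field
that contains `0` and `1`. -/
structure IsCoefficientSet {R : Type*} [CommRing R] [IsLocalRing R] (CS : Set R) : Prop where
  bijOn : Set.BijOn (IsLocalRing.residue R) CS Set.univ
  zero_mem : (0 : R) ∈ CS
  one_mem : (1 : R) ∈ CS

end KeyPoly

end

/-!
The elements `P_i` are constructed one after the other, as key polynomials of the valuation.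

Suppose that `P_0, …, P_i` and `U_1, …, U_{i-1}` are given, with `n̄_s`, `d_s` finite for
`1 ≤ s < i` and `n_s = n̄_s d_s`. It is convenient to work with Laurent monomials in the `P_s`
(`KeyPoly.lmono`), called reduced if the exponent of `P_s` is in `[0, n_s)` for `s ≥ 1`. For two
Laurent monomials of the same value the exponents of the last factor are congruent modulo its index
`n̄`, so the class of their quotient is a power of the last `α` times the class of a quotient of
Laurent monomials in the previous terms (`KeyPoly.res_lmono_div_lmono`). By induction on the number
of terms, and since `1, α, …, α^{d-1}` is a basis of the next residue field extension, this gives the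
two halves of one statement: the classes of the quotients of the reduced Laurent monomials of a given
value by one Laurent monomial of that value are linearly independent over `k`
(`KeyPoly.linearIndependent_res_lmono`), and they span `k(α_1, …, α_{i-1})`
(`KeyPoly.mem_span_res_lmono`).

As `n_s ν(P_s) < ν(P_{s+1})`, a reduced Laurent monomial in `P_0, …, P_{i-1}` of value at least
`ν(P_i)` has a positive exponent of `P_0` (`KeyPoly.IsReduced.exponent_zero_pos`), so it is a genuine
monomial. If `n̄_i` is finite, the spanning property thus yields `U_i`. If `d_i` is finite as well, it
expresses the coefficient `b_{i,t}` of the minimal polynomial of `α_i` as the class of a combination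
of reduced monomials divided by `U_i^{d_i-t}`; the lift of the minimal polynomial along these
expressions is `P_{i+1}`, whose value exceeds `n_i ν(P_i)` because `α_i` is a root
(`KeyPoly.IsKeySequence.exists_isNext`).

The positive exponent of `P_0 = x` also shows that `P_i` is congruent to a power of `y` modulo `x`.
By Krull's principal ideal theorem no power of `y` lies in `(x)`, so `P_i ≠ 0` and all values are
finite (`KeyPoly.isKeySequence_of_isStep`). The dimension enters
only here and, by the same argument, in `x ≠ 0`.
-/

noncomputable section

namespace KeyPoly

/-! ### Values and residues -/

section Values

variable {K Γ : Type*} [Field K] [AddCommGroup Γ] [LinearOrder Γ] [IsOrderedAddMonoid Γ]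
  (ν : AddValuation K (WithTop Γ))

/-- The value of `z` as an element of the group `Γ`, with the dummy value `0` at `z = 0`. -/
def val (z : K) : Γ := (ν z).untopD 0

variable {ν}

theorem coe_val {z : K} (hz : z ≠ 0) : ((val ν z : Γ) : WithTop Γ) = ν z := by
  obtain ⟨γ, hγ⟩ := WithTop.ne_top_iff_exists.1 (ν.ne_top_iff.2 hz)
  simp [val, ← hγ]

theorem val_eq_iff {z z' : K} (hz : z ≠ 0) (hz' : z' ≠ 0) : val ν z = val ν z' ↔ ν z = ν z' := by
  rw [← coe_val hz, ← coe_val hz', WithTop.coe_inj]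

theorem val_one : val ν (1 : K) = 0 := by simp [val]

theorem val_mul {a b : K} (ha : a ≠ 0) (hb : b ≠ 0) : val ν (a * b) = val ν a + val ν b := by
  apply WithTop.coe_injective
  rw [WithTop.coe_add, coe_val ha, coe_val hb, coe_val (mul_ne_zero ha hb), ν.map_mul]

theorem val_inv {a : K} (ha : a ≠ 0) : val ν a⁻¹ = -val ν a := by
  have h := val_mul (ν := ν) ha (inv_ne_zero ha)
  rw [mul_inv_cancel₀ ha, val_one] at h
  exact eq_neg_of_add_eq_zero_right h.symm

theorem val_div {a b : K} (ha : a ≠ 0) (hb : b ≠ 0) : val ν (a / b) = val ν a - val ν b := by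
  rw [div_eq_mul_inv, val_mul ha (inv_ne_zero hb), val_inv hb, sub_eq_add_neg]

theorem val_pow {a : K} (ha : a ≠ 0) (n : ℕ) : val ν (a ^ n) = n • val ν a := by
  induction n with
  | zero => simp [val_one]
  | succ n ih => rw [pow_succ, val_mul (pow_ne_zero _ ha) ha, ih, succ_nsmul]

theorem val_zpow {a : K} (ha : a ≠ 0) (n : ℤ) : val ν (a ^ n) = n • val ν a := by
  cases n with
  | ofNat n => simpa using val_pow ha n
  | negSucc n =>
    rw [zpow_negSucc, val_inv (pow_ne_zero _ ha), val_pow ha, negSucc_zsmul]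

theorem val_prod {ι : Type*} (s : Finset ι) (f : ι → K) (hf : ∀ i ∈ s, f i ≠ 0) :
    val ν (∏ i ∈ s, f i) = ∑ i ∈ s, val ν (f i) := by
  classical
  induction s using Finset.induction_on with
  | empty => simp [val_one]
  | insert a s ha ih =>
    rw [Finset.prod_insert ha, Finset.sum_insert ha, val_mul (hf a (by simp))
      (Finset.prod_ne_zero_iff.2 fun i hi => hf i (by simp [hi])),
      ih fun i hi => hf i (by simp [hi])]

theorem nu_div_eq_zero {a b : K} (ha : a ≠ 0) (hb : b ≠ 0) (h : ν a = ν b) : ν (a / b) = 0 := by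
  rw [← coe_val (div_ne_zero ha hb), val_div ha hb, (val_eq_iff ha hb).2 h, sub_self,
    WithTop.coe_zero]

theorem res_mk {f : K} (hf : 0 ≤ ν f) :
    res ν f = IsLocalRing.residue (valRing ν) ⟨f, hf⟩ := by
  have : f ∈ valRing ν := hf
  simp only [res, this, dif_pos]

theorem res_mul {a b : K} (ha : 0 ≤ ν a) (hb : 0 ≤ ν b) : res ν (a * b) = res ν a * res ν b := by
  rw [res_mk ha, res_mk hb, ← map_mul, res_mk (by rw [ν.map_mul]; exact add_nonneg ha hb)]
  rfl

theorem res_one : res ν (1 : K) = 1 := by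
  rw [res_mk (by simp)]
  exact map_one _

theorem res_zero : res ν (0 : K) = 0 := by
  rw [res_mk (by simp)]
  exact map_zero _

theorem res_add {a b : K} (ha : 0 ≤ ν a) (hb : 0 ≤ ν b) : res ν (a + b) = res ν a + res ν b := by
  rw [res_mk ha, res_mk hb, ← map_add, res_mk (ν.map_le_add ha hb)]
  rfl

theorem res_sum {ι : Type*} (s : Finset ι) (f : ι → K) (hf : ∀ i ∈ s, 0 ≤ ν (f i)) :
    res ν (∑ i ∈ s, f i) = ∑ i ∈ s, res ν (f i) := by
  classical
  induction s using Finset.induction_on with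
  | empty => simp [res_zero]
  | insert a s ha ih =>
    rw [Finset.sum_insert ha, Finset.sum_insert ha, res_add (hf a (by simp))
      (ν.map_le_sum fun i hi => hf i (by simp [hi])), ih fun i hi => hf i (by simp [hi])]

theorem res_pow {a : K} (ha : 0 ≤ ν a) (n : ℕ) : res ν (a ^ n) = res ν a ^ n := by
  induction n with
  | zero => simp [res_one]
  | succ n ih =>
    rw [pow_succ, pow_succ, res_mul (by rw [ν.map_pow]; exact nsmul_nonneg ha n) ha, ih]

theorem res_eq_zero_iff {a : K} (ha : 0 ≤ ν a) : res ν a = 0 ↔ 0 < ν a := by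
  rw [res_mk ha, IsLocalRing.residue_eq_zero_iff, IsLocalRing.mem_maximalIdeal, mem_nonunits_iff]
  constructor
  · intro h
    refine lt_of_le_of_ne ha fun h0 => h ?_
    have ha0 : a ≠ 0 := by
      rintro rfl
      simp at h0
    have hinv : 0 ≤ ν a⁻¹ := by
      rw [← coe_val (inv_ne_zero ha0), val_inv ha0]
      rw [← coe_val ha0, ← WithTop.coe_zero, WithTop.coe_inj] at h0
      rw [← h0, neg_zero, WithTop.coe_zero]
    exact IsUnit.of_mul_eq_one (⟨a⁻¹, hinv⟩ : valRing ν)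
      (Subtype.ext (mul_inv_cancel₀ ha0))
  · intro h hu
    obtain ⟨b, hb⟩ := hu.exists_right_inv
    have h1 : a * (b : K) = 1 := congrArg Subtype.val hb
    have h2 : ν a + ν (b : K) = 0 := by rw [← ν.map_mul, h1, ν.map_one]
    have h3 : 0 ≤ ν (b : K) := b.2
    exact absurd h2 (add_pos_of_pos_of_nonneg h h3).ne'

theorem res_ne_zero {a : K} (ha : ν a = 0) : res ν a ≠ 0 := by
  intro h
  rw [res_eq_zero_iff ha.ge, ha] at h
  exact lt_irrefl _ h

theorem res_inv {a : K} (ha : ν a = 0) : res ν a⁻¹ = (res ν a)⁻¹ := by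
  have ha0 : a ≠ 0 := by
    rintro rfl
    simp at ha
  have h := nu_div_eq_zero (ν := ν) one_ne_zero ha0 (by rw [ha, ν.map_one])
  rw [one_div] at h
  refine eq_inv_of_mul_eq_one_left ?_
  rw [← res_mul h.ge ha.ge, inv_mul_cancel₀ ha0, res_one]

theorem res_zpow {a : K} (ha : ν a = 0) (n : ℤ) : res ν (a ^ n) = res ν a ^ n := by
  cases n with
  | ofNat n => simpa using res_pow ha.ge n
  | negSucc n =>
    rw [zpow_negSucc, zpow_negSucc, res_inv (by rw [ν.map_pow, ha, smul_zero]), res_pow ha.ge]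

theorem nu_zpow_eq_zero {a : K} (ha : ν a = 0) (n : ℤ) : ν (a ^ n) = 0 := by
  have ha0 : a ≠ 0 := by
    rintro rfl
    simp at ha
  rw [← coe_val ha0, ← WithTop.coe_zero, WithTop.coe_inj] at ha
  rw [← coe_val (zpow_ne_zero _ ha0), val_zpow ha0, ha, smul_zero, WithTop.coe_zero]

theorem res_algebraMap {R : Type*} [CommRing R] [IsLocalRing R] [Algebra R K]
    (h : Dominates R ν) (a : R) :
    res ν (algebraMap R K a) = residueMap h (IsLocalRing.residue R a) := by
  rw [res_mk (h.nonneg a)]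
  rfl

end Values

/-! ### Laurent monomials -/

section LaurentMonomials

variable {R : Type*} (K : Type*) {Γ : Type*} [CommRing R] [Field K] [Algebra R K]
  [AddCommGroup Γ] [LinearOrder Γ] [IsOrderedAddMonoid Γ]

/-- The Laurent monomial `P_0^{e_0} ⋯ P_{m-1}^{e_{m-1}}` in the field `K`, with integer
exponents. -/
def lmono (P : ℕ → R) (e : ℕ → ℤ) (m : ℕ) : K :=
  ∏ s ∈ Finset.range m, algebraMap R K (P s) ^ e s

variable {K} {ν : AddValuation K (WithTop Γ)} {P : ℕ → R} {m : ℕ}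

theorem lmono_succ (e : ℕ → ℤ) : lmono K P e (m + 1) = lmono K P e m * algebraMap R K (P m) ^ e m :=
  Finset.prod_range_succ _ _

theorem lmono_one (e : ℕ → ℤ) : lmono K P e 1 = algebraMap R K (P 0) ^ e 0 := by
  simp [lmono]

theorem lmono_zero (m : ℕ) : lmono K P 0 m = 1 := by
  simp [lmono]

theorem algebraMap_mono (e : ℕ → ℕ) :
    algebraMap R K (mono P e m) = lmono K P (fun s => (e s : ℤ)) m := by
  simp [mono, lmono, map_prod]

theorem lmono_ne_zero (hp : ∀ s < m, algebraMap R K (P s) ≠ 0) (e : ℕ → ℤ) : lmono K P e m ≠ 0 :=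
  Finset.prod_ne_zero_iff.2 fun s hs => zpow_ne_zero _ (hp s (Finset.mem_range.1 hs))

theorem lmono_add (hp : ∀ s < m, algebraMap R K (P s) ≠ 0) (e e' : ℕ → ℤ) :
    lmono K P (e + e') m = lmono K P e m * lmono K P e' m := by
  rw [lmono, lmono, lmono, ← Finset.prod_mul_distrib]
  exact Finset.prod_congr rfl fun s hs => zpow_add₀ (hp s (Finset.mem_range.1 hs)) _ _

theorem lmono_sub (hp : ∀ s < m, algebraMap R K (P s) ≠ 0) (e e' : ℕ → ℤ) :
    lmono K P (e - e') m = lmono K P e m / lmono K P e' m := by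
  rw [eq_div_iff (lmono_ne_zero hp e'), ← lmono_add hp, sub_add_cancel]

theorem lmono_smul (a : ℤ) (e : ℕ → ℤ) : lmono K P (a • e) m = lmono K P e m ^ a := by
  rw [lmono, lmono, ← Finset.prod_zpow]
  exact Finset.prod_congr rfl fun s _ => by
    rw [Pi.smul_apply, smul_eq_mul, mul_comm, zpow_mul]

theorem lmono_congr {e e' : ℕ → ℤ} (h : ∀ s < m, e s = e' s) : lmono K P e m = lmono K P e' m :=
  Finset.prod_congr rfl fun s hs => by rw [h s (Finset.mem_range.1 hs)]

theorem val_lmono (hp : ∀ s < m, algebraMap R K (P s) ≠ 0) (e : ℕ → ℤ) :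
    val ν (lmono K P e m) = ∑ s ∈ Finset.range m, e s • val ν (algebraMap R K (P s)) := by
  rw [lmono, val_prod _ _ fun s hs => zpow_ne_zero _ (hp s (Finset.mem_range.1 hs))]
  exact Finset.sum_congr rfl fun s hs => val_zpow (hp s (Finset.mem_range.1 hs)) _

theorem valGroup_succ (hm : algebraMap R K (P m) ≠ 0) :
    valGroup ν P (m + 1) =
      valGroup ν P m ⊔ AddSubgroup.zmultiples (val ν (algebraMap R K (P m))) := by
  rw [valGroup, valGroup, AddSubgroup.zmultiples_eq_closure, ← AddSubgroup.closure_union]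
  congr 1
  ext γ
  simp only [Set.mem_ofPred_eq, Set.mem_union, Set.mem_singleton_iff]
  constructor
  · rintro ⟨j, hj, h⟩
    rcases Nat.lt_succ_iff_lt_or_eq.1 hj with hj | rfl
    · exact Or.inl ⟨j, hj, h⟩
    · right
      rw [← coe_val hm, WithTop.coe_inj] at h
      exact h.symm
  · rintro (⟨j, hj, h⟩ | rfl)
    · exact ⟨j, hj.trans (Nat.lt_succ_self m), h⟩
    · exact ⟨m, Nat.lt_succ_self m, (coe_val hm).symm⟩

theorem mem_valGroup_iff (hp : ∀ s < m, algebraMap R K (P s) ≠ 0) (γ : Γ) :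
    γ ∈ valGroup ν P m ↔ ∃ e : ℕ → ℤ, val ν (lmono K P e m) = γ := by
  induction m generalizing γ with
  | zero =>
    simp [valGroup, lmono, val_one, eq_comm]
  | succ m ih =>
    have hp' : ∀ s < m, algebraMap R K (P s) ≠ 0 := fun s hs => hp s (hs.trans (Nat.lt_succ_self m))
    rw [valGroup_succ (hp m (Nat.lt_succ_self m)), AddSubgroup.mem_sup]
    constructor
    · rintro ⟨a, ha, b, hb, rfl⟩
      obtain ⟨e, rfl⟩ := (ih hp' a).1 ha
      obtain ⟨q, rfl⟩ := AddSubgroup.mem_zmultiples_iff.1 hb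
      refine ⟨Function.update e m q, ?_⟩
      rw [lmono_succ, val_mul (lmono_ne_zero hp' _) (zpow_ne_zero _ (hp m (Nat.lt_succ_self m))),
        val_zpow (hp m (Nat.lt_succ_self m)), Function.update_self]
      congr 2
      exact lmono_congr fun s hs => Function.update_of_ne hs.ne _ _
    · rintro ⟨e, rfl⟩
      refine ⟨_, (ih hp' _).2 ⟨e, rfl⟩, _, AddSubgroup.mem_zmultiples_iff.2 ⟨e m, rfl⟩, ?_⟩
      rw [lmono_succ, val_mul (lmono_ne_zero hp' _) (zpow_ne_zero _ (hp m (Nat.lt_succ_self m))),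
        val_zpow (hp m (Nat.lt_succ_self m))]

/-- The index `n̄_m` is the order of `ν(P_m)` modulo `G(ν(P_0), …, ν(P_{m-1}))`. This includes the
case of an infinite index, encoded as `0`. -/
theorem zsmul_val_mem_valGroup_iff (hm : algebraMap R K (P m) ≠ 0) (a : ℤ) :
    a • val ν (algebraMap R K (P m)) ∈ valGroup ν P m ↔ (nbar ν P m : ℤ) ∣ a := by
  have h : nbar ν P m =
      addOrderOf (QuotientAddGroup.mk' (valGroup ν P m) (val ν (algebraMap R K (P m)))) := by
    rw [nbar, valGroup_succ hm, sup_comm, ← Nat.card_zmultiples, ← AddMonoidHom.map_zmultiples,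
      ← AddSubgroup.relIndex_ker, QuotientAddGroup.ker_mk', AddSubgroup.relIndex_sup_right]
  rw [h, addOrderOf_dvd_iff_zsmul_eq_zero, ← map_zsmul, QuotientAddGroup.mk'_apply,
    QuotientAddGroup.eq_zero_iff]

end LaurentMonomials

/-! ### Simple extensions of subfields -/

section SimpleExtension

open Polynomial

variable {L : Type*} [Field L] {A : Subfield L} {α : L}

theorem le_closure_union_singleton : A ≤ Subfield.closure ((A : Set L) ∪ {α}) := fun _ ha =>
  Subfield.subset_closure (Or.inl ha)

theorem extendScalars_closure_eq_adjoin :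
    Subfield.extendScalars (le_closure_union_singleton (A := A) (α := α)) =
      IntermediateField.adjoin A {α} := by
  apply IntermediateField.toSubfield_injective
  rw [Subfield.extendScalars_toSubfield, IntermediateField.adjoin]
  change _ = Subfield.closure (Set.range (algebraMap A L) ∪ {α})
  congr 2
  ext a
  simp [Subfield.algebraMap_ofSubfield]

theorem relfinrank_closure :
    A.relfinrank (Subfield.closure ((A : Set L) ∪ {α})) =
      Module.finrank A (IntermediateField.adjoin A {α}) := by
  rw [Subfield.relfinrank_eq_finrank_of_le le_closure_union_singleton,
    extendScalars_closure_eq_adjoin]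

theorem natDegree_minpoly_eq_relfinrank (hα : IsIntegral A α) :
    (minpoly A α).natDegree = A.relfinrank (Subfield.closure ((A : Set L) ∪ {α})) := by
  rw [relfinrank_closure, IntermediateField.adjoin.finrank hα]

theorem isIntegral_of_relfinrank_ne_zero
    (hd : A.relfinrank (Subfield.closure ((A : Set L) ∪ {α})) ≠ 0) : IsIntegral A α := by
  rw [relfinrank_closure] at hd
  have : FiniteDimensional A (IntermediateField.adjoin A {α}) :=
    FiniteDimensional.of_finrank_pos (Nat.pos_of_ne_zero hd)
  have h := IsIntegral.of_finite A (IntermediateField.AdjoinSimple.gen A α)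
  rwa [IntermediateField.AdjoinSimple.isIntegral_gen] at h

/-- The powers `α^t` are linearly independent over `A`, where `t < [A(α) : A]` if this degree is
finite and `t` is arbitrary otherwise. -/
theorem eq_zero_of_sum_mul_pow_eq_zero (s : Finset ℕ)
    (hs : ∀ t ∈ s, A.relfinrank (Subfield.closure ((A : Set L) ∪ {α})) ≠ 0 →
      t < A.relfinrank (Subfield.closure ((A : Set L) ∪ {α})))
    (c : ℕ → L) (hc : ∀ t ∈ s, c t ∈ A) (h : ∑ t ∈ s, c t * α ^ t = 0) : ∀ t ∈ s, c t = 0 := by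
  classical
  let p : A[X] := ∑ t ∈ s.attach, C ⟨c t, hc t t.2⟩ * X ^ (t : ℕ)
  have hp : aeval α p = 0 := by
    rw [← h, ← Finset.sum_attach s]
    simp only [p, map_sum, map_mul, aeval_C, map_pow, aeval_X]
    rfl
  have hcoeff : ∀ t (ht : t ∈ s), p.coeff t = ⟨c t, hc t ht⟩ := by
    intro t ht
    simp only [p, finsetSum_coeff, coeff_C_mul, coeff_X_pow]
    rw [Finset.sum_eq_single ⟨t, ht⟩]
    · simp
    · intro b _ hb
      rw [if_neg, mul_zero]
      rintro rfl
      exact hb rfl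
    · intro hn
      exact absurd (Finset.mem_attach _ _) hn
  have hp0 : p = 0 := by
    by_contra hne
    have hα : IsIntegral A α := (show IsAlgebraic A α from ⟨p, hne, hp⟩).isIntegral
    have hdeg := natDegree_minpoly_eq_relfinrank hα
    have hpos := minpoly.natDegree_pos hα
    have hlt : p.degree < (minpoly A α).degree := by
      rw [degree_eq_natDegree (minpoly.ne_zero hα), degree_lt_iff_coeff_zero]
      intro t ht
      by_cases hts : t ∈ s
      · have := hs t hts (by omega)
        omega
      · simp only [p, finsetSum_coeff, coeff_C_mul, coeff_X_pow]
        refine Finset.sum_eq_zero fun b _ => ?_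
        rw [if_neg, mul_zero]
        rintro rfl
        exact hts b.2
    exact absurd (minpoly.degree_le_of_ne_zero A α hne hp) (not_le.2 hlt)
  intro t ht
  have := hcoeff t ht
  rw [hp0, coeff_zero] at this
  exact (congrArg Subtype.val this).symm

theorem exists_eq_sum_mul_pow
    (hd : A.relfinrank (Subfield.closure ((A : Set L) ∪ {α})) ≠ 0) {β : L}
    (hβ : β ∈ Subfield.closure ((A : Set L) ∪ {α})) :
    ∃ c : ℕ → L, (∀ t, c t ∈ A) ∧
      β = ∑ t ∈ Finset.range (A.relfinrank (Subfield.closure ((A : Set L) ∪ {α}))),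
        c t * α ^ t := by
  have hα := isIntegral_of_relfinrank_ne_zero hd
  have hmem : β ∈ IntermediateField.adjoin A {α} := by
    rw [← extendScalars_closure_eq_adjoin]
    exact hβ
  rw [← IntermediateField.mem_toSubalgebra,
    IntermediateField.adjoin_simple_toSubalgebra_of_isAlgebraic hα.isAlgebraic,
    Algebra.adjoin_singleton_eq_range_aeval] at hmem
  obtain ⟨p, rfl⟩ := hmem
  have hmod : aeval α p = aeval α (p %ₘ minpoly A α) := by
    conv_lhs => rw [← modByMonic_add_div p (minpoly A α)]
    simp
  refine ⟨fun t => (p %ₘ minpoly A α).coeff t, fun t => SetLike.coe_mem _, ?_⟩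
  change aeval α p = _
  rw [hmod, ← natDegree_minpoly_eq_relfinrank hα, aeval_eq_sum_range' (n := (minpoly A α).natDegree)]
  · rfl
  · exact natDegree_modByMonic_lt _ (minpoly.monic hα) (minpoly.ne_one A α)

end SimpleExtension

/-! ### Residues of Laurent monomials -/

section Residues

variable {R K Γ : Type*} [CommRing R] [Field K] [Algebra R K]
  [AddCommGroup Γ] [LinearOrder Γ] [IsOrderedAddMonoid Γ] {ν : AddValuation K (WithTop Γ)}
  {P : ℕ → R} {w : ℕ → ℕ → ℕ} {m : ℕ}

/-- The exponent vector `w_m`, with integer entries. -/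
abbrev zexp (w : ℕ → ℕ → ℕ) (m : ℕ) : ℕ → ℤ := fun s => (w m s : ℤ)

/-- The monomial `U_m` (prescribed by `w`) has the value of `P_m^{n̄_m}` if the index `n̄_m` is
finite. -/
def IsValMono (ν : AddValuation K (WithTop Γ)) (P : ℕ → R) (w : ℕ → ℕ → ℕ) (m : ℕ) : Prop :=
  nbar ν P m ≠ 0 →
    ν (algebraMap R K (P m) ^ nbar ν P m) = ν (algebraMap R K (mono P (w m) m))

/-- Two Laurent monomials of the same value whose exponents of `P_m` are congruent modulo `n̄_m`
differ by a power of `P_m^{n̄_m} / U_m` and a Laurent monomial in `P_0, …, P_{m-1}`. -/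
theorem lmono_div_lmono (hp : ∀ s < m + 1, algebraMap R K (P s) ≠ 0) {e e' : ℕ → ℤ} {r q t : ℤ}
    (he : e m = r + nbar ν P m * q) (he' : e' m = r + nbar ν P m * t) :
    lmono K P e' (m + 1) / lmono K P e (m + 1) =
      (algebraMap R K (P m) ^ nbar ν P m / algebraMap R K (mono P (w m) m)) ^ (t - q) *
        (lmono K P e' m / lmono K P (e + (q - t) • zexp w m) m) := by
  have hp' : ∀ s < m, algebraMap R K (P s) ≠ 0 := fun s hs => hp s (hs.trans (Nat.lt_succ_self m))
  have hm := hp m (Nat.lt_succ_self m)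
  have hU := lmono_ne_zero (K := K) hp' (zexp w m)
  have hE := lmono_ne_zero (K := K) hp' e
  have h1 : algebraMap R K (P m) ^ e' m / algebraMap R K (P m) ^ e m =
      (algebraMap R K (P m) ^ nbar ν P m) ^ (t - q) := by
    rw [← zpow_sub₀ hm, he, he', ← zpow_natCast, ← zpow_mul]
    congr 1
    ring
  have h2 : lmono K P (zexp w m) m ^ (t - q) = (lmono K P (zexp w m) m ^ (q - t))⁻¹ := by
    rw [← zpow_neg, neg_sub]
  rw [lmono_succ, lmono_succ, lmono_add hp', lmono_smul, algebraMap_mono, div_zpow, ← h1, h2]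
  have h3 := zpow_ne_zero (q - t) hU
  have h4 := zpow_ne_zero (e m) hm
  field_simp

theorem nu_quotient_zpow (hp : ∀ s < m + 1, algebraMap R K (P s) ≠ 0) (hw : IsValMono ν P w m)
    {a : ℤ} (ha : nbar ν P m = 0 → a = 0) :
    ν ((algebraMap R K (P m) ^ nbar ν P m / algebraMap R K (mono P (w m) m)) ^ a) = 0 ∧
      res ν ((algebraMap R K (P m) ^ nbar ν P m / algebraMap R K (mono P (w m) m)) ^ a) =
        alpha ν P w m ^ a := by
  by_cases hn : nbar ν P m = 0
  · rw [ha hn]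
    simp [res_one]
  · have hp' : ∀ s < m, algebraMap R K (P s) ≠ 0 :=
      fun s hs => hp s (hs.trans (Nat.lt_succ_self m))
    have h0 : ν (algebraMap R K (P m) ^ nbar ν P m / algebraMap R K (mono P (w m) m)) = 0 := by
      refine nu_div_eq_zero (pow_ne_zero _ (hp m (Nat.lt_succ_self m))) ?_ (hw hn)
      rw [algebraMap_mono]
      exact lmono_ne_zero hp' _
    refine ⟨nu_zpow_eq_zero h0 a, ?_⟩
    rw [res_zpow h0, alpha, if_neg hn]

theorem alpha_ne_zero (hp : ∀ s < m + 1, algebraMap R K (P s) ≠ 0) (hw : IsValMono ν P w m) :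
    alpha ν P w m ≠ 0 := by
  by_cases hn : nbar ν P m = 0
  · rw [alpha, if_pos hn]
    exact one_ne_zero
  · have h1 := nu_quotient_zpow hp hw (a := 1) fun h0 => absurd h0 hn
    rw [← zpow_one (alpha ν P w m), ← h1.2]
    exact res_ne_zero h1.1

theorem nu_lmono_eq_iff (hp : ∀ s < m + 1, algebraMap R K (P s) ≠ 0) (hw : IsValMono ν P w m)
    {e e' : ℕ → ℤ} {r q t : ℤ}
    (he : e m = r + nbar ν P m * q) (he' : e' m = r + nbar ν P m * t)
    (hqt : nbar ν P m = 0 → t - q = 0) :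
    ν (lmono K P e' (m + 1)) = ν (lmono K P e (m + 1)) ↔
      ν (lmono K P e' m) = ν (lmono K P (e + (q - t) • zexp w m) m) := by
  have hp' : ∀ s < m, algebraMap R K (P s) ≠ 0 := fun s hs => hp s (hs.trans (Nat.lt_succ_self m))
  have h1 := lmono_div_lmono (w := w) hp he he'
  have h2 := (nu_quotient_zpow hp hw hqt).1
  have h3 : (algebraMap R K (P m) ^ nbar ν P m / algebraMap R K (mono P (w m) m)) ^ (t - q) ≠ 0 := by
    intro h0
    rw [h0] at h2
    simp at h2
  have a1 := lmono_ne_zero (K := K) hp e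
  have a2 := lmono_ne_zero (K := K) hp e'
  have a3 := lmono_ne_zero (K := K) hp' e'
  have a4 := lmono_ne_zero (K := K) hp' (e + (q - t) • zexp w m)
  have h4 := congrArg (val ν) h1
  rw [val_div a2 a1, val_mul h3 (div_ne_zero a3 a4), val_div a3 a4] at h4
  have h5 : val ν ((algebraMap R K (P m) ^ nbar ν P m / algebraMap R K (mono P (w m) m)) ^ (t - q))
      = 0 := by
    rw [← coe_val h3, ← WithTop.coe_zero, WithTop.coe_inj] at h2
    exact h2
  rw [h5, zero_add] at h4
  rw [← val_eq_iff a2 a1, ← val_eq_iff a3 a4, ← sub_eq_zero, h4, sub_eq_zero]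

theorem res_lmono_div_lmono (hp : ∀ s < m + 1, algebraMap R K (P s) ≠ 0) (hw : IsValMono ν P w m)
    {e e' : ℕ → ℤ} {r q t : ℤ}
    (he : e m = r + nbar ν P m * q) (he' : e' m = r + nbar ν P m * t)
    (hqt : nbar ν P m = 0 → t - q = 0)
    (hv : ν (lmono K P e' (m + 1)) = ν (lmono K P e (m + 1))) :
    res ν (lmono K P e' (m + 1) / lmono K P e (m + 1)) =
      alpha ν P w m ^ (t - q) *
        res ν (lmono K P e' m / lmono K P (e + (q - t) • zexp w m) m) := by
  have hp' : ∀ s < m, algebraMap R K (P s) ≠ 0 := fun s hs => hp s (hs.trans (Nat.lt_succ_self m))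
  have h2 := nu_quotient_zpow hp hw hqt
  rw [lmono_div_lmono (w := w) hp he he', res_mul h2.1.ge, h2.2]
  exact (nu_div_eq_zero (lmono_ne_zero hp' _) (lmono_ne_zero hp' _)
    ((nu_lmono_eq_iff hp hw he he' hqt).1 hv)).ge

theorem nbar_dvd_sub (hp : ∀ s < m + 1, algebraMap R K (P s) ≠ 0) {e e' : ℕ → ℤ}
    (hv : ν (lmono K P e' (m + 1)) = ν (lmono K P e (m + 1))) :
    (nbar ν P m : ℤ) ∣ e' m - e m := by
  have hp' : ∀ s < m, algebraMap R K (P s) ≠ 0 := fun s hs => hp s (hs.trans (Nat.lt_succ_self m))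
  have hm := hp m (Nat.lt_succ_self m)
  rw [← zsmul_val_mem_valGroup_iff hm, mem_valGroup_iff hp']
  refine ⟨e - e', ?_⟩
  rw [← val_eq_iff (lmono_ne_zero hp _) (lmono_ne_zero hp _), lmono_succ, lmono_succ,
    val_mul (lmono_ne_zero hp' _) (zpow_ne_zero _ hm), val_mul (lmono_ne_zero hp' _)
    (zpow_ne_zero _ hm), val_zpow hm, val_zpow hm] at hv
  rw [lmono_sub hp', val_div (lmono_ne_zero hp' _) (lmono_ne_zero hp' _), sub_smul]
  rw [sub_eq_sub_iff_add_eq_add, ← hv, add_comm]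

/-- The Euclidean division by `n̄_m` of the exponents of `P_m` in two Laurent monomials of the same
value. If `n̄_m` encodes an infinite index, the quotients are `0`. -/
theorem exists_common_remainder (hp : ∀ s < m + 1, algebraMap R K (P s) ≠ 0) {e e' : ℕ → ℤ}
    (hv : ν (lmono K P e' (m + 1)) = ν (lmono K P e (m + 1))) :
    e' m = e m % nbar ν P m + nbar ν P m * (e' m / nbar ν P m) := by
  have h1 := nbar_dvd_sub hp hv
  rw [← Int.emod_eq_emod_iff_emod_sub_eq_zero.2 (Int.emod_eq_zero_of_dvd h1), Int.emod_add_mul_ediv]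

variable [IsLocalRing R] (h : Dominates R ν)

theorem adjField_one : adjField h P w 1 = baseField h := by
  rw [adjField]
  have : {a | ∃ j, 1 ≤ j ∧ j < 1 ∧ a = alpha ν P w j} = ∅ := by
    ext a
    simp only [Set.mem_ofPred_eq, Set.mem_empty_iff_false, iff_false]
    rintro ⟨j, h1, h2, -⟩
    omega
  rw [this, Set.union_empty, Subfield.closure_eq]

theorem adjField_succ (hm : 1 ≤ m) :
    adjField h P w (m + 1) =
      Subfield.closure ((adjField h P w m : Set (ResField ν)) ∪ {alpha ν P w m}) := by
  apply le_antisymm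
  · refine Subfield.closure_le.2 ?_
    rintro a (ha | ⟨j, h1, h2, rfl⟩)
    · exact Subfield.subset_closure (Or.inl (Subfield.subset_closure (Or.inl ha)))
    · rcases Nat.lt_succ_iff_lt_or_eq.1 h2 with h2 | rfl
      · exact Subfield.subset_closure (Or.inl (Subfield.subset_closure (Or.inr ⟨j, h1, h2, rfl⟩)))
      · exact Subfield.subset_closure (Or.inr rfl)
  · refine Subfield.closure_le.2 ?_
    rintro a (ha | rfl)
    · refine Subfield.closure_mono ?_ ha
      rintro b (hb | ⟨j, h1, h2, rfl⟩)
      · exact Or.inl hb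
      · exact Or.inr ⟨j, h1, h2.trans (Nat.lt_succ_self m), rfl⟩
    · exact Subfield.subset_closure (Or.inr ⟨m, hm, Nat.lt_succ_self m, rfl⟩)

theorem adjField_le_succ : adjField h P w m ≤ adjField h P w (m + 1) := by
  refine Subfield.closure_mono (Set.union_subset_union_right _ ?_)
  rintro _ ⟨j, h1, h2, rfl⟩
  exact ⟨j, h1, h2.trans (Nat.lt_succ_self m), rfl⟩

theorem deg_eq_relfinrank (hm : 1 ≤ m) :
    deg h P w m = (adjField h P w m).relfinrank
      (Subfield.closure ((adjField h P w m : Set (ResField ν)) ∪ {alpha ν P w m})) := by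
  rw [deg, adjField_succ h hm]

theorem baseField_le_adjField : baseField h ≤ adjField h P w m := fun _ ha =>
  Subfield.subset_closure (Or.inl ha)

/-- The class of a Laurent monomial of value `0` is a product of powers of `α_1, …, α_{m-1}`: the
exponent of the last factor is a multiple of its index, so this factor can be split off. -/
theorem res_lmono_mem_adjField (hm : 1 ≤ m) (hp : ∀ s < m, algebraMap R K (P s) ≠ 0)
    (h0 : 0 < val ν (algebraMap R K (P 0)))
    (hw : ∀ s, 1 ≤ s → s < m → IsValMono ν P w s) (e : ℕ → ℤ) (he : ν (lmono K P e m) = 0) :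
    res ν (lmono K P e m) ∈ adjField h P w m := by
  induction m, hm using Nat.le_induction generalizing e with
  | base =>
    have : e 0 = 0 := by
      have hp0 := hp 0 Nat.one_pos
      rw [lmono_one, ← coe_val (zpow_ne_zero _ hp0), val_zpow hp0, ← WithTop.coe_zero,
        WithTop.coe_inj] at he
      exact (smul_eq_zero.1 he).resolve_right h0.ne'
    rw [lmono_one, this, zpow_zero, res_one]
    exact one_mem _
  | succ m hm ih =>
    have hp' : ∀ s < m, algebraMap R K (P s) ≠ 0 :=
      fun s hs => hp s (hs.trans (Nat.lt_succ_self m))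
    have hwm := hw m hm (Nat.lt_succ_self m)
    have hv : ν (lmono K P e (m + 1)) = ν (lmono K P 0 (m + 1)) := by
      rw [he, lmono_zero, ν.map_one]
    have he' := exists_common_remainder hp hv
    have hq : (0 : ℕ → ℤ) m = (0 : ℕ → ℤ) m % nbar ν P m + nbar ν P m * 0 := by simp
    have hqt : nbar ν P m = 0 → e m / nbar ν P m - 0 = 0 := fun h0 => by simp [h0]
    have h1 := res_lmono_div_lmono hp hwm hq he' hqt hv
    have h2 := (nu_lmono_eq_iff hp hwm hq he' hqt).1 hv
    rw [lmono_zero, div_one] at h1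
    rw [h1, ← lmono_sub hp']
    refine mul_mem (zpow_mem ?_ _) (adjField_le_succ h (ih hp'
      (fun s h1 h2 => hw s h1 (h2.trans (Nat.lt_succ_self m))) _ ?_))
    · exact Subfield.subset_closure (Or.inr ⟨m, hm, Nat.lt_succ_self m, rfl⟩)
    · rw [lmono_sub hp']
      exact nu_div_eq_zero (lmono_ne_zero hp' _) (lmono_ne_zero hp' _) h2

end Residues

/-! ### Reduced monomials: independence, generation and values -/

section Reduced

variable {R K Γ : Type*} [CommRing R] [IsLocalRing R] [Field K] [Algebra R K]
  [AddCommGroup Γ] [LinearOrder Γ] [IsOrderedAddMonoid Γ] {ν : AddValuation K (WithTop Γ)}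
  (h : Dominates R ν) {P : ℕ → R} {w : ℕ → ℕ → ℕ} {m : ℕ}

/-- Distinct reduced monomials of the same value have `k`-linearly independent quotients. Their
exponents of the last term are congruent modulo `n̄`, so the quotients are, up to a common factor, of
the form `α^t a` with `a` in the field generated by the previous `α`'s. The powers of `α` that occur
are independent over that field, and for a fixed `t` the elements `a` are independent by induction.
No bound on the exponent of `P_s` is needed where `n̄_s` or `d_s` is infinite. -/
theorem linearIndependent_res_lmono (hm : 1 ≤ m) (hp : ∀ s < m, algebraMap R K (P s) ≠ 0)
    (h0 : 0 < val ν (algebraMap R K (P 0)))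
    (hw : ∀ s, 1 ≤ s → s < m → IsValMono ν P w s) {ι : Type*} (j : ι → ℕ → ℤ)
    (hnn : ∀ l s, 1 ≤ s → s < m → 0 ≤ j l s)
    (hred : ∀ l s, 1 ≤ s → s < m → nbar ν P s ≠ 0 → deg h P w s ≠ 0 →
      j l s < (nbar ν P s * deg h P w s : ℕ))
    (hinj : ∀ l l', (∀ s < m, j l s = j l' s) → l = l') (e : ℕ → ℤ)
    (hv : ∀ l, ν (lmono K P (j l) m) = ν (lmono K P e m)) :
    LinearIndependent (baseField h) fun l => res ν (lmono K P (j l) m / lmono K P e m) := by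
  classical
  induction m, hm using Nat.le_induction generalizing ι e with
  | base =>
    have hp0 := hp 0 Nat.one_pos
    have key : ∀ l l' : ι, l = l' := by
      intro l l'
      have hv' := (hv l).trans (hv l').symm
      rw [lmono_one, lmono_one, ← val_eq_iff (zpow_ne_zero _ hp0) (zpow_ne_zero _ hp0),
        val_zpow hp0, val_zpow hp0] at hv'
      refine hinj l l' fun s hs => ?_
      obtain rfl : s = 0 := by omega
      exact (zsmul_left_strictMono h0).injective hv'
    have : Subsingleton ι := ⟨key⟩
    rcases isEmpty_or_nonempty ι with hι | ⟨⟨l⟩⟩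
    · exact linearIndependent_empty_type
    · exact LinearIndependent.of_subsingleton l
        (res_ne_zero (nu_div_eq_zero (lmono_ne_zero hp _) (lmono_ne_zero hp _) (hv l)))
  | succ m hm ih =>
    have hp' : ∀ s < m, algebraMap R K (P s) ≠ 0 :=
      fun s hs => hp s (hs.trans (Nat.lt_succ_self m))
    have hw' : ∀ s, 1 ≤ s → s < m → IsValMono ν P w s :=
      fun s h1 h2 => hw s h1 (h2.trans (Nat.lt_succ_self m))
    have hwm := hw m hm (Nat.lt_succ_self m)
    set N := nbar ν P m with hN
    set α := alpha ν P w m with hα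
    have hα0 : α ≠ 0 := alpha_ne_zero hp hwm
    set q : ℤ := e m / N with hq
    have he : e m = e m % N + N * q := (Int.emod_add_mul_ediv _ _).symm
    let t : ι → ℕ := fun l => (j l m / N).toNat
    have ht : ∀ l, ((t l : ℕ) : ℤ) = j l m / N := fun l =>
      Int.toNat_of_nonneg (Int.ediv_nonneg (hnn l m hm (Nat.lt_succ_self m)) (by positivity))
    have he' : ∀ l, j l m = e m % N + N * (t l : ℤ) := by
      intro l
      rw [ht]
      exact exists_common_remainder hp (hv l)
    have hqt : ∀ l, N = 0 → (t l : ℤ) - q = 0 := fun l h0 => by rw [ht, hq]; simp [h0]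
    let a : ι → ResField ν := fun l =>
      res ν (lmono K P (j l) m / lmono K P (e + (q - t l) • zexp w m) m)
    have hlow : ∀ l, ν (lmono K P (j l) m) = ν (lmono K P (e + (q - t l) • zexp w m) m) :=
      fun l => (nu_lmono_eq_iff hp hwm he (he' l) (hqt l)).1 (hv l)
    have ha : ∀ l, a l ∈ adjField h P w m := by
      intro l
      simp only [a]
      rw [← lmono_sub hp']
      refine res_lmono_mem_adjField h hm hp' h0 hw' _ ?_
      rw [lmono_sub hp']
      exact nu_div_eq_zero (lmono_ne_zero hp' _) (lmono_ne_zero hp' _) (hlow l)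
    rw [linearIndependent_iff']
    intro s g hsum l₀ hl₀
    -- clear the common factor `α ^ (-q)`, then group the terms by the exponent of `α`
    have hsum' : ∑ l ∈ s, ((g l : ResField ν) * a l) * α ^ t l = 0 := by
      have h1 : ∀ l ∈ s, ((g l : ResField ν) * a l) * α ^ t l =
          α ^ q * (g l • res ν (lmono K P (j l) (m + 1) / lmono K P e (m + 1))) := by
        intro l _
        rw [res_lmono_div_lmono hp hwm he (he' l) (hqt l) (hv l), Subfield.smul_def, smul_eq_mul,
          zpow_sub₀ hα0, zpow_natCast]
        have := zpow_ne_zero q hα0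
        simp only [a]
        field_simp
      rw [Finset.sum_congr rfl h1, ← Finset.mul_sum, hsum, mul_zero]
    have hfib : ∑ b ∈ s.image t, (∑ l ∈ s with t l = b, (g l : ResField ν) * a l) * α ^ b = 0 := by
      rw [← hsum', ← Finset.sum_fiberwise_of_maps_to
        (fun l hl => Finset.mem_image_of_mem t hl) (f := fun l => ((g l : ResField ν) * a l) * α ^ t l)]
      refine Finset.sum_congr rfl fun b _ => ?_
      rw [Finset.sum_mul]
      refine Finset.sum_congr rfl fun l hl => ?_
      rw [(Finset.mem_filter.1 hl).2]
    have hzero := eq_zero_of_sum_mul_pow_eq_zero (A := adjField h P w m) (α := α) (s.image t) (by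
        intro b hb hd
        rw [← deg_eq_relfinrank h hm] at hd ⊢
        obtain ⟨l, -, rfl⟩ := Finset.mem_image.1 hb
        by_cases hN0 : N = 0
        · have : t l = 0 := by
            simp only [t, hN0]
            simp
          omega
        · have h1 := hred l m hm (Nat.lt_succ_self m) hN0 hd
          rw [← Int.ofNat_lt, ht l]
          refine Int.ediv_lt_of_lt_mul (by omega) ?_
          push_cast at h1
          rw [mul_comm]
          exact h1) _ (by
        intro b _
        exact sum_mem fun l _ => mul_mem (baseField_le_adjField h (g l).2) (ha l)) hfib
      (t l₀) (Finset.mem_image_of_mem t hl₀)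
    have hli := ih hp' hw' (ι := {l // t l = t l₀}) (fun l => j l)
      (fun l s h1 h2 => hnn l s h1 (h2.trans (Nat.lt_succ_self m)))
      (fun l s h1 h2 => hred l s h1 (h2.trans (Nat.lt_succ_self m)))
      (fun l l' hll => Subtype.ext (hinj l l' fun s hs => by
        rcases Nat.lt_succ_iff_lt_or_eq.1 hs with hs | rfl
        · exact hll s hs
        · rw [he' l, he' l', l.2, l'.2]))
      (e + (q - t l₀) • zexp w m) (fun l => by
        have := hlow l
        rwa [l.2] at this)
    rw [linearIndependent_iff'] at hli
    refine hli (s.subtype _) (fun l => g l) ?_ ⟨l₀, rfl⟩ (by simpa using hl₀)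
    rw [← hzero, ← Finset.sum_subtype_eq_sum_filter]
    refine Finset.sum_congr rfl fun l _ => ?_
    simp only [a, l.2]
    rfl

/-- The Laurent monomials in `P_0, …, P_{m-1}` whose exponents of `P_1, …, P_{m-1}` lie in the
ranges `0 ≤ e_s < n̄_s d_s`; the exponent of `P_0` is any integer. -/
def IsReduced (P : ℕ → R) (w : ℕ → ℕ → ℕ) (m : ℕ) (e : ℕ → ℤ) : Prop :=
  ∀ s, 1 ≤ s → s < m → 0 ≤ e s ∧ e s < (nbar ν P s * deg h P w s : ℕ)

/-- Every element of `k(α_1, …, α_{m-1})` is a `k`-linear combination of quotients of reduced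
Laurent monomials, of any prescribed value in the group generated by the values of
`P_0, …, P_{m-1}`, by a fixed Laurent monomial of that value. -/
theorem mem_span_res_lmono (hm : 1 ≤ m) (hp : ∀ s < m, algebraMap R K (P s) ≠ 0)
    (hw : ∀ s, 1 ≤ s → s < m → IsValMono ν P w s)
    (hact : ∀ s, 1 ≤ s → s < m → nbar ν P s ≠ 0 ∧ deg h P w s ≠ 0) (e : ℕ → ℤ)
    {β : ResField ν} (hβ : β ∈ adjField h P w m) :
    β ∈ Submodule.span (baseField h) {b | ∃ e', IsReduced h P w m e' ∧
      ν (lmono K P e' m) = ν (lmono K P e m) ∧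
      b = res ν (lmono K P e' m / lmono K P e m)} := by
  induction m, hm using Nat.le_induction generalizing e β with
  | base =>
    rw [adjField_one] at hβ
    have h1 : (1 : ResField ν) ∈ {b | ∃ e', IsReduced h P w 1 e' ∧
        ν (lmono K P e' 1) = ν (lmono K P e 1) ∧
        b = res ν (lmono K P e' 1 / lmono K P e 1)} :=
      ⟨e, fun s h1 h2 => by omega, rfl, by rw [div_self (lmono_ne_zero hp e), res_one]⟩
    have h2 := Submodule.smul_mem _ (⟨β, hβ⟩ : baseField h)
      (Submodule.subset_span (R := baseField h) h1)
    rwa [Subfield.smul_def, smul_eq_mul, mul_one] at h2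
  | succ m hm ih =>
    have hp' : ∀ s < m, algebraMap R K (P s) ≠ 0 :=
      fun s hs => hp s (hs.trans (Nat.lt_succ_self m))
    have hwm := hw m hm (Nat.lt_succ_self m)
    obtain ⟨hN0, hd0⟩ := hact m hm (Nat.lt_succ_self m)
    have hα0 : alpha ν P w m ≠ 0 := alpha_ne_zero hp hwm
    set N := nbar ν P m with hN
    set α := alpha ν P w m with hα
    set d := deg h P w m with hd
    set q : ℤ := e m / N with hq
    have he : e m = e m % N + N * q := (Int.emod_add_mul_ediv _ _).symm
    have hαmem : α ∈ adjField h P w (m + 1) :=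
      Subfield.subset_closure (Or.inr ⟨m, hm, Nat.lt_succ_self m, rfl⟩)
    have hβq := mul_mem hβ (zpow_mem hαmem q)
    have hdr := deg_eq_relfinrank (w := w) (P := P) h hm
    rw [adjField_succ h hm] at hβq
    obtain ⟨c, hc, hsum⟩ := exists_eq_sum_mul_pow (by rwa [← hdr]) hβq
    rw [← hdr] at hsum
    have hβsum : β = ∑ t ∈ Finset.range d, c t * α ^ ((t : ℤ) - q) := by
      rw [← mul_inv_cancel_right₀ (zpow_ne_zero q hα0) β, hsum, Finset.sum_mul]
      refine Finset.sum_congr rfl fun t _ => ?_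
      rw [zpow_sub₀ hα0, zpow_natCast, mul_assoc, div_eq_mul_inv]
    rw [hβsum]
    refine Submodule.sum_mem _ fun t ht => ?_
    have hct := ih hp' (fun s h1 h2 => hw s h1 (h2.trans (Nat.lt_succ_self m)))
      (fun s h1 h2 => hact s h1 (h2.trans (Nat.lt_succ_self m)))
      (e + (q - t) • zexp w m) (hc t)
    generalize c t = γ at hct ⊢
    induction hct using Submodule.span_induction with
    | zero => rw [zero_mul]; exact Submodule.zero_mem _
    | add x y _ _ hx hy => rw [add_mul]; exact Submodule.add_mem _ hx hy
    | smul b x _ hx => rw [smul_mul_assoc]; exact Submodule.smul_mem _ _ hx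
    | mem b hb =>
      obtain ⟨e', hred, hv, rfl⟩ := hb
      have hr0 : 0 ≤ e m % N := Int.emod_nonneg _ (by exact_mod_cast hN0)
      have hr1 : e m % N < N := Int.emod_lt_of_pos _ (by omega)
      set e'' := Function.update e' m (e m % N + N * t) with he''
      have hlow : lmono K P e'' m = lmono K P e' m :=
        lmono_congr fun s hs => Function.update_of_ne hs.ne _ _
      have hm'' : e'' m = e m % N + N * t := Function.update_self _ _ _
      have hv'' := (nu_lmono_eq_iff hp hwm he hm'' (fun h0 => absurd h0 hN0)).2 (by
        rw [hlow]
        exact hv)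
      refine Submodule.subset_span ⟨e'', ?_, hv'', ?_⟩
      · intro s h1 h2
        rcases Nat.lt_succ_iff_lt_or_eq.1 h2 with h2 | rfl
        · rw [he'', Function.update_of_ne h2.ne]
          exact hred s h1 h2
        · rw [hm'']
          refine ⟨by positivity, ?_⟩
          have ht' : (t : ℤ) + 1 ≤ d := by exact_mod_cast Finset.mem_range.1 ht
          have : (N : ℤ) * (t + 1) ≤ N * d := mul_le_mul_of_nonneg_left ht' (by positivity)
          push_cast
          linarith
      · rw [res_lmono_div_lmono hp hwm he hm'' (fun h0 => absurd h0 hN0) hv'', hlow, mul_comm]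

/-- If `n_s v_s < v_{s+1}` for all `s`, then reduced combinations of `v_1, …, v_{m-1}` are less
than `v_m`. -/
theorem sum_smul_lt (hm : 1 ≤ m) {v : ℕ → Γ} {n : ℕ → ℕ} {e : ℕ → ℤ}
    (hpos : ∀ s, 1 ≤ s → s ≤ m → 0 < v s)
    (hlt : ∀ s, 1 ≤ s → s < m → n s • v s < v (s + 1))
    (he : ∀ s, 1 ≤ s → s < m → e s < n s) :
    ∑ s ∈ Finset.Ico 1 m, e s • v s < v m := by
  induction m, hm using Nat.le_induction with
  | base => simpa using hpos 1 le_rfl le_rfl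
  | succ m hm ih =>
    have h1 := ih (fun s a b => hpos s a (b.trans (Nat.le_succ m)))
      (fun s a b => hlt s a (b.trans (Nat.lt_succ_self m)))
      (fun s a b => he s a (b.trans (Nat.lt_succ_self m)))
    rw [Finset.sum_Ico_succ_top hm]
    have h2 := he m hm (Nat.lt_succ_self m)
    have h3 : (e m + 1) • v m ≤ (n m : ℤ) • v m :=
      zsmul_le_zsmul_left (hpos m hm (Nat.le_succ m)).le (by omega)
    rw [natCast_zsmul] at h3
    calc ∑ s ∈ Finset.Ico 1 m, e s • v s + e m • v m < v m + e m • v m := by gcongr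
      _ = (e m + 1) • v m := by rw [add_smul, one_smul, add_comm]
      _ ≤ n m • v m := h3
      _ < v (m + 1) := hlt m hm (Nat.lt_succ_self m)

/-- A reduced Laurent monomial in `P_0, …, P_{m-1}` of value at least `ν(P_m)` has a positive
exponent of `P_0`. -/
theorem IsReduced.exponent_zero_pos {e : ℕ → ℤ} (he : IsReduced h P w m e) (hm : 1 ≤ m)
    (hp : ∀ s ≤ m, algebraMap R K (P s) ≠ 0)
    (hpos : ∀ s ≤ m, 0 < val ν (algebraMap R K (P s)))
    (hlt : ∀ s, 1 ≤ s → s < m → (nbar ν P s * deg h P w s) • val ν (algebraMap R K (P s)) <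
      val ν (algebraMap R K (P (s + 1))))
    (hv : val ν (algebraMap R K (P m)) ≤ val ν (lmono K P e m)) : 0 < e 0 := by
  rw [val_lmono (fun s hs => hp s hs.le), Finset.range_eq_Ico,
    Finset.sum_eq_sum_Ico_succ_bot (by omega)] at hv
  have h1 := sum_smul_lt (e := e) hm (fun s _ b => hpos s b) hlt fun s a b => (he s a b).2
  by_contra hneg
  have h2 : e 0 • val ν (algebraMap R K (P 0)) ≤ 0 :=
    smul_nonpos_of_nonpos_of_nonneg (not_lt.1 hneg) (hpos 0 (Nat.zero_le m)).le
  exact absurd (hv.trans (add_le_add_left h2 _)) (by simpa using h1)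

end Reduced

/-! ### Construction of the next element -/

section NextElement

variable {R K Γ : Type*} [CommRing R] [IsLocalRing R] [Field K] [Algebra R K]
  [AddCommGroup Γ] [LinearOrder Γ] [IsOrderedAddMonoid Γ] {ν : AddValuation K (WithTop Γ)}

/-- The properties of `P_0, …, P_i` and `U_1, …, U_{i-1}` from which `U_i` and `P_{i+1}` are
constructed. -/
structure IsKeySequence (h : Dominates R ν) (P : ℕ → R) (w : ℕ → ℕ → ℕ) (i : ℕ) : Prop where
  ne_zero : ∀ s ≤ i, algebraMap R K (P s) ≠ 0
  pos : ∀ s ≤ i, 0 < val ν (algebraMap R K (P s))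
  lt : ∀ s, 1 ≤ s → s < i → (nbar ν P s * deg h P w s) • val ν (algebraMap R K (P s)) <
    val ν (algebraMap R K (P (s + 1)))
  isValMono : ∀ s, 1 ≤ s → s < i → IsValMono ν P w s
  finite : ∀ s, 1 ≤ s → s < i → nbar ν P s ≠ 0 ∧ deg h P w s ≠ 0

/-- `p` is a possible choice of `P_{i+1}`, with `λ`, `c` and `σ` describing its expression in
`P_0, …, P_i`. Every monomial in the expression is moreover divisible by `P_0`. -/
structure IsNext (h : Dominates R ν) (CS : Set R) (P : ℕ → R) (w : ℕ → ℕ → ℕ) (i : ℕ)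
    (p : R) (lam : ℕ) (c : ℕ → R) (σ : ℕ → ℕ → ℕ) : Prop where
  eq : p = P i ^ (nbar ν P i * deg h P w i) +
    ∑ k ∈ Finset.Icc 1 lam, c k * mono P (σ k) (i + 1)
  one_le : 1 ≤ lam
  mem : ∀ k, 1 ≤ k → k ≤ lam → c k ∈ CS
  coeff_ne_zero : ∀ k, 1 ≤ k → k ≤ lam → c k ≠ 0
  exponent_lt : ∀ k, 1 ≤ k → k ≤ lam → ∀ s, 1 ≤ s → s ≤ i → σ k s < nbar ν P s * deg h P w s
  exponent_zero_pos : ∀ k, 1 ≤ k → k ≤ lam → 0 < σ k 0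
  dvd : ∀ k, 1 ≤ k → k ≤ lam → nbar ν P i ∣ σ k i
  nu_eq : ∀ k, 1 ≤ k → k ≤ lam → (nbar ν P i * deg h P w i) • ν (algebraMap R K (P i)) =
    ν (algebraMap R K (mono P (σ k) (i + 1)))
  nu_lt : (nbar ν P i * deg h P w i) • ν (algebraMap R K (P i)) < ν (algebraMap R K p)
  bcoef_mem : ∀ t < deg h P w i,
    bcoef h P (fun _ => lam) (fun _ => c) (fun _ => σ) w i t ∈ adjField h P w i
  minpoly_eq : (minpoly (adjField h P w i) (alpha ν P w i)).map
      (algebraMap (adjField h P w i) (ResField ν)) =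
    Polynomial.X ^ deg h P w i + ∑ t ∈ Finset.range (deg h P w i),
      Polynomial.C (bcoef h P (fun _ => lam) (fun _ => c) (fun _ => σ) w i t) * Polynomial.X ^ t

variable {h : Dominates R ν} {P : ℕ → R} {w : ℕ → ℕ → ℕ} {i : ℕ}

theorem IsReduced.exists_nat {m : ℕ} {e : ℕ → ℤ} (he : IsReduced h P w m e) (h0 : 0 ≤ e 0) :
    ∃ u : ℕ → ℕ, (∀ s, 1 ≤ s → s < m → u s < nbar ν P s * deg h P w s) ∧ (u 0 : ℤ) = e 0 ∧
      algebraMap R K (mono P u m) = lmono K P e m := by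
  have key : ∀ s < m, ((e s).toNat : ℤ) = e s := fun s hs => by
    apply Int.toNat_of_nonneg
    rcases Nat.eq_zero_or_pos s with rfl | hs0
    · exact h0
    · exact (he s hs0 hs).1
  refine ⟨fun s => (e s).toNat, fun s h1 h2 => ?_, Int.toNat_of_nonneg h0, ?_⟩
  · have := (he s h1 h2).2
    rw [← key s h2] at this
    exact_mod_cast this
  · rw [algebraMap_mono]
    exact lmono_congr key

/-- The monomial `U_i` exists: since `1` is a combination of reduced monomials of value `n̄_i ν(P_i)`,
there is at least one of them. -/
theorem IsKeySequence.exists_valMono (hk : IsKeySequence h P w i) (hi : 1 ≤ i)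
    (hn : nbar ν P i ≠ 0) :
    ∃ u : ℕ → ℕ, (∀ s, 1 ≤ s → s < i → u s < nbar ν P s * deg h P w s) ∧
      ν (algebraMap R K (P i) ^ nbar ν P i) = ν (algebraMap R K (mono P u i)) := by
  have hp : ∀ s < i, algebraMap R K (P s) ≠ 0 := fun s hs => hk.ne_zero s hs.le
  have hpi := hk.ne_zero i le_rfl
  obtain ⟨e, he⟩ := (mem_valGroup_iff hp _).1
    ((zsmul_val_mem_valGroup_iff (ν := ν) hpi (nbar ν P i)).2 dvd_rfl)
  have hspan := mem_span_res_lmono h hi hp hk.isValMono hk.finite e (one_mem _)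
  obtain ⟨-, e', hred, hv, -⟩ : Set.Nonempty {b | ∃ e', IsReduced h P w i e' ∧
      ν (lmono K P e' i) = ν (lmono K P e i) ∧ b = res ν (lmono K P e' i / lmono K P e i)} := by
    rw [Set.nonempty_iff_ne_empty]
    intro hempty
    rw [hempty, Submodule.span_empty, Submodule.mem_bot] at hspan
    exact one_ne_zero hspan
  have hv' : val ν (lmono K P e' i) = nbar ν P i • val ν (algebraMap R K (P i)) := by
    rw [(val_eq_iff (lmono_ne_zero hp _) (lmono_ne_zero hp _)).2 hv, he, natCast_zsmul]
  have hpos : 0 < e' 0 := by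
    refine hred.exponent_zero_pos h hi hk.ne_zero hk.pos hk.lt ?_
    rw [hv']
    exact le_self_nsmul (hk.pos i le_rfl).le hn
  obtain ⟨u, hu, -, hmono⟩ := hred.exists_nat hpos.le
  refine ⟨u, hu, ?_⟩
  rw [hmono, ← val_eq_iff (pow_ne_zero _ hpi) (lmono_ne_zero hp _), hv', val_pow hpi]

theorem exists_bijOn_Icc {ι : Type*} [Nonempty ι] (S : Finset ι) :
    ∃ g : ℕ → ι, Set.BijOn g (Finset.Icc 1 S.card) S := by
  refine (Finset.finite_toSet _).exists_bijOn_of_encard_eq ?_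
  rw [Set.encard_coe_eq_coe_finsetCard, Set.encard_coe_eq_coe_finsetCard, Nat.card_Icc,
    Nat.add_sub_cancel]

/-- Lifting of scalars from `k ⊆ L` to a coefficient set. -/
theorem exists_lift {CS : Set R} (hCS : IsCoefficientSet CS) :
    ∃ γ : baseField h → R, (∀ a, γ a ∈ CS) ∧ (∀ a, a ≠ 0 → γ a ≠ 0) ∧
      ∀ a, res ν (algebraMap R K (γ a)) = a := by
  have key : ∀ a : baseField h, ∃ r ∈ CS, res ν (algebraMap R K r) = a := by
    rintro ⟨a, b, rfl⟩
    obtain ⟨r, hr, rfl⟩ := hCS.bijOn.surjOn (Set.mem_univ b)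
    exact ⟨r, hr, res_algebraMap h r⟩
  choose γ hγ hres using key
  refine ⟨γ, hγ, fun a ha h0 => ha (Subtype.ext ?_), hres⟩
  rw [← hres a, h0, map_zero, res_zero]
  rfl

/-- If `n̄_i` and `d_i` are finite, the coefficients of the minimal polynomial of `α_i` are
combinations of reduced monomials over powers of `U_i`. Lifting the scalars to the coefficient set
turns the minimal polynomial into the expression of `P_{i+1}`. -/
theorem IsKeySequence.exists_isNext (hk : IsKeySequence h P w i) (hi : 1 ≤ i)
    {CS : Set R} (hCS : IsCoefficientSet CS) (hw : IsValMono ν P w i)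
    (hn : nbar ν P i ≠ 0) (hd : deg h P w i ≠ 0) :
    ∃ p lam c σ, IsNext h CS P w i p lam c σ := by
  classical
  have hp : ∀ s < i, algebraMap R K (P s) ≠ 0 := fun s hs => hk.ne_zero s hs.le
  have hp1 : ∀ s < i + 1, algebraMap R K (P s) ≠ 0 := fun s hs => hk.ne_zero s (Nat.le_of_lt_succ hs)
  have hpi := hk.ne_zero i le_rfl
  set N := nbar ν P i with hN
  set d := deg h P w i with hdd
  set α := alpha ν P w i with hα
  set U := algebraMap R K (mono P (w i) i) with hU
  set A := adjField h P w i with hA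
  have hU0 : U ≠ 0 := by rw [hU, algebraMap_mono]; exact lmono_ne_zero hp _
  have hvU : val ν U = N • val ν (algebraMap R K (P i)) := by
    rw [← val_pow hpi, val_eq_iff hU0 (pow_ne_zero _ hpi)]
    exact (hw hn).symm
  have hα0 : α ≠ 0 := alpha_ne_zero hp1 hw
  have hdr := deg_eq_relfinrank (w := w) (P := P) h hi
  have hint : IsIntegral A α := isIntegral_of_relfinrank_ne_zero (by rwa [← hdr])
  have hdeg : (minpoly A α).natDegree = d := by rw [natDegree_minpoly_eq_relfinrank hint, ← hdr]
  let e : ℕ → ℕ → ℤ := fun t => ((d - t : ℕ) : ℤ) • zexp w i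
  have hlU : ∀ t, lmono K P (e t) i = U ^ (d - t) := fun t => by
    rw [lmono_smul, zpow_natCast, hU, algebraMap_mono]
  have hspan := fun t => Submodule.mem_span_set.1
    (mem_span_res_lmono h hi hp hk.isValMono hk.finite (e t) ((minpoly A α).coeff t).2)
  choose ct hsupp hsum using hspan
  have hexp : ∀ t l, t < d → l ∈ (ct t).support → ∃ u : ℕ → ℕ,
      (∀ s, 1 ≤ s → s < i → u s < nbar ν P s * deg h P w s) ∧ 0 < u 0 ∧
      ν (algebraMap R K (mono P u i)) = ν (U ^ (d - t)) ∧
      res ν (algebraMap R K (mono P u i) / U ^ (d - t)) = l := by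
    intro t l ht hl
    obtain ⟨e', hred, hv, hl'⟩ := hsupp t hl
    have hpos : 0 < e' 0 := by
      refine hred.exponent_zero_pos h hi hk.ne_zero hk.pos hk.lt ?_
      rw [(val_eq_iff (lmono_ne_zero hp _) (lmono_ne_zero hp _)).2 hv, hlU, val_pow hU0, hvU,
        smul_smul]
      exact le_self_nsmul (hk.pos i le_rfl).le (Nat.mul_ne_zero (by omega) hn)
    obtain ⟨u, hu, hu0, hmono⟩ := hred.exists_nat hpos.le
    rw [hlU] at hv hl'
    exact ⟨u, hu, by omega, by rw [hmono, hv], by rw [hmono, hl']⟩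
  choose! u hu hu0 hnu hres using hexp
  obtain ⟨γ, hγ, hγ0, hγres⟩ := exists_lift (h := h) hCS
  -- the monomials of the expression are indexed by the pairs `(t, l)`, where `t` is the degree in
  -- the minimal polynomial and `l ∈ L` the class of the monomial over `U_i ^ (d_i - t)`
  let S : Finset (Σ _ : ℕ, ResField ν) := (Finset.range d).sigma fun t => (ct t).support
  obtain ⟨g, hg⟩ := exists_bijOn_Icc S
  have hgS : ∀ k, 1 ≤ k → k ≤ S.card → (g k).1 < d ∧ (g k).2 ∈ (ct (g k).1).support := by
    intro k h1 h2
    have := hg.mapsTo (Finset.mem_coe.2 (Finset.mem_Icc.2 ⟨h1, h2⟩))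
    rwa [Finset.mem_coe, Finset.mem_sigma, Finset.mem_range] at this
  let c : ℕ → R := fun k => γ (ct (g k).1 (g k).2)
  let σ : ℕ → ℕ → ℕ := fun k s => if s = i then (g k).1 * N else u (g k).1 (g k).2 s
  have hσi : ∀ k, σ k i = (g k).1 * N := fun k => if_pos rfl
  have hσ : ∀ k s, s < i → σ k s = u (g k).1 (g k).2 s := fun k s hs => if_neg hs.ne
  have hmi : ∀ k, mono P (σ k) i = mono P (u (g k).1 (g k).2) i := fun k =>
    Finset.prod_congr rfl fun s hs => by rw [hσ k s (Finset.mem_range.1 hs)]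
  have hms : ∀ k, mono P (σ k) (i + 1) = mono P (u (g k).1 (g k).2) i * P i ^ ((g k).1 * N) := by
    intro k
    rw [mono, Finset.prod_range_succ, hσi]
    exact congrArg (· * _) (hmi k)
  -- `B t` is an element of `V_ν` whose class is the coefficient `b_{i,t}`
  let B : ℕ → K := fun t => ∑ l ∈ (ct t).support,
    algebraMap R K (γ (ct t l)) * (algebraMap R K (mono P (u t l) i) / U ^ (d - t))
  have hquot : ∀ t < d, ∀ l ∈ (ct t).support,
      0 ≤ ν (algebraMap R K (mono P (u t l) i) / U ^ (d - t)) := by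
    intro t ht l hl
    refine (nu_div_eq_zero ?_ (pow_ne_zero _ hU0) (hnu t l ht hl)).ge
    rw [algebraMap_mono]
    exact lmono_ne_zero hp _
  have hterm : ∀ t < d, ∀ l ∈ (ct t).support, 0 ≤ ν (algebraMap R K (γ (ct t l)) *
      (algebraMap R K (mono P (u t l) i) / U ^ (d - t))) := by
    intro t ht l hl
    rw [ν.map_mul]
    exact add_nonneg (h.nonneg _) (hquot t ht l hl)
  have hB0 : ∀ t < d, 0 ≤ ν (B t) := fun t ht => ν.map_le_sum fun l hl => hterm t ht l hl
  have hBres : ∀ t < d, res ν (B t) = (minpoly A α).coeff t := by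
    intro t ht
    rw [res_sum _ _ (hterm t ht), ← hsum t, Finsupp.sum]
    refine Finset.sum_congr rfl fun l hl => ?_
    rw [res_mul (h.nonneg _) (hquot t ht l hl), hγres, hres t l ht hl, Subfield.smul_def,
      smul_eq_mul]
  have hbcoef : ∀ t < d,
      bcoef h P (fun _ => S.card) (fun _ => c) (fun _ => σ) w i t = (minpoly A α).coeff t := by
    intro t ht
    rw [← hBres t ht, bcoef]
    congr 1
    rw [Finset.sum_filter]
    have h1 : ∑ a ∈ S, (if a.1 * N = t * N then algebraMap R K (γ (ct a.1 a.2)) *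
        (algebraMap R K (mono P (u a.1 a.2) i) / U ^ (d - t)) else 0) = B t := by
      rw [Finset.sum_sigma, Finset.sum_eq_single t]
      · exact Finset.sum_congr rfl fun l _ => if_pos rfl
      · intro t' _ hne
        refine Finset.sum_eq_zero fun l _ => if_neg fun h0 => hne ?_
        exact Nat.eq_of_mul_eq_mul_right (Nat.pos_of_ne_zero hn) h0
      · intro hn'
        exact absurd (Finset.mem_range.2 ht) hn'
    rw [← h1]
    refine Finset.sum_nbij g (fun k hk => hg.mapsTo hk) hg.injOn hg.surjOn fun k _ => ?_
    rw [hσi, hmi]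
  refine ⟨_, S.card, c, σ, rfl, ?_, fun k _ _ => hγ _, ?_, ?_, ?_, ?_, ?_, ?_, ?_, ?_⟩
  · -- the constant coefficient of the minimal polynomial is nonzero since `α_i ≠ 0`
    have h0 : (minpoly A α).coeff 0 ≠ 0 := minpoly.coeff_zero_ne_zero hint hα0
    have hne : (ct 0).support.Nonempty := by
      rw [Finset.nonempty_iff_ne_empty]
      intro hempty
      have := hsum 0
      rw [Finsupp.sum, hempty, Finset.sum_empty] at this
      exact h0 (Subtype.ext this.symm)
    obtain ⟨l, hl⟩ := hne
    exact Finset.card_pos.2 ⟨⟨0, l⟩, Finset.mem_sigma.2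
      ⟨Finset.mem_range.2 (Nat.pos_of_ne_zero hd), hl⟩⟩
  · intro k h1 h2
    exact hγ0 _ (Finsupp.mem_support_iff.1 (hgS k h1 h2).2)
  · intro k h1 h2 s hs1 hs2
    obtain ⟨ht, hl⟩ := hgS k h1 h2
    rcases hs2.lt_or_eq with hs2 | rfl
    · rw [hσ k s hs2]
      exact hu _ _ ht hl s hs1 hs2
    · rw [hσi, mul_comm]
      exact Nat.mul_lt_mul_of_pos_left ht (Nat.pos_of_ne_zero hn)
  · intro k h1 h2
    obtain ⟨ht, hl⟩ := hgS k h1 h2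
    rw [hσ k 0 (by omega)]
    exact hu0 _ _ ht hl
  · intro k _ _
    rw [hσi]
    exact dvd_mul_left _ _
  · intro k h1 h2
    obtain ⟨ht, hl⟩ := hgS k h1 h2
    rw [hms, map_mul, map_pow, ν.map_mul, hnu _ _ ht hl, ← ν.map_mul, ← ν.map_pow,
      ← val_eq_iff (pow_ne_zero _ hpi) (mul_ne_zero (pow_ne_zero _ hU0) (pow_ne_zero _ hpi)),
      val_mul (pow_ne_zero _ hU0) (pow_ne_zero _ hpi), val_pow hpi, val_pow hpi, val_pow hU0, hvU,
      smul_smul, ← add_smul, ← add_mul, Nat.sub_add_cancel ht.le, mul_comm]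
  · set q := algebraMap R K (P i) ^ N / U with hq
    have hq0 : ν q = 0 := nu_div_eq_zero (pow_ne_zero _ hpi) hU0 (hw hn)
    have hqres : res ν q = α := by rw [hα, alpha, if_neg hn]
    -- over `U_i ^ d_i`, the class of `P_{i+1}` is the minimal polynomial evaluated at `α_i`
    have hdiv : algebraMap R K (P i ^ (N * d) +
        ∑ k ∈ Finset.Icc 1 S.card, c k * mono P (σ k) (i + 1)) =
          U ^ d * (q ^ d + ∑ t ∈ Finset.range d, q ^ t * B t) := by
      have h1 : ∑ k ∈ Finset.Icc 1 S.card, algebraMap R K (c k * mono P (σ k) (i + 1)) =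
          ∑ a ∈ S, U ^ d * (q ^ a.1 * (algebraMap R K (γ (ct a.1 a.2)) *
            (algebraMap R K (mono P (u a.1 a.2) i) / U ^ (d - a.1)))) := by
        refine Finset.sum_nbij g (fun k hk => hg.mapsTo hk) hg.injOn hg.surjOn fun k hk => ?_
        obtain ⟨ht, -⟩ := hgS k (Finset.mem_Icc.1 hk).1 (Finset.mem_Icc.1 hk).2
        rw [hms, map_mul, map_mul, map_pow, hq, div_pow, ← pow_mul]
        have hUd : U ^ d = U ^ (g k).1 * U ^ (d - (g k).1) := by
          rw [← pow_add, Nat.add_sub_cancel' ht.le]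
        rw [hUd, mul_comm N]
        have := pow_ne_zero (g k).1 hU0
        have := pow_ne_zero (d - (g k).1) hU0
        field_simp
        exact mul_comm _ _
      rw [map_add, map_pow, map_sum, h1, mul_add, hq, div_pow, ← pow_mul,
        mul_div_cancel₀ _ (pow_ne_zero _ hU0), Finset.sum_sigma, Finset.mul_sum]
      simp only [B, Finset.mul_sum]
    have hterm' : ∀ t ∈ Finset.range d, 0 ≤ ν (q ^ t * B t) := fun t ht => by
      rw [ν.map_mul, ν.map_pow, hq0, smul_zero, zero_add]
      exact hB0 t (Finset.mem_range.1 ht)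
    have hqd : 0 ≤ ν (q ^ d) := by rw [ν.map_pow, hq0, smul_zero]
    have hpos : 0 < ν (q ^ d + ∑ t ∈ Finset.range d, q ^ t * B t) := by
      rw [← res_eq_zero_iff (ν.map_le_add hqd (ν.map_le_sum hterm')),
        res_add hqd (ν.map_le_sum hterm'), res_sum _ _ hterm', res_pow hq0.ge, hqres]
      have haeval := minpoly.aeval A α
      rw [(minpoly.monic hint).as_sum, hdeg] at haeval
      simp only [map_add, map_sum, map_mul, map_pow, Polynomial.aeval_X, Polynomial.aeval_C]
        at haeval
      rw [← haeval]
      congr 1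
      refine Finset.sum_congr rfl fun t ht => ?_
      have ht' := Finset.mem_range.1 ht
      rw [res_mul (by rw [ν.map_pow, hq0, smul_zero]) (hB0 t ht'), res_pow hq0.ge, hqres,
        hBres t ht', mul_comm]
      rfl
    have hUd : (N * d) • ν (algebraMap R K (P i)) = ν (U ^ d) := by
      rw [← ν.map_pow, ← val_eq_iff (pow_ne_zero _ hpi) (pow_ne_zero _ hU0), val_pow hpi,
        val_pow hU0, hvU, smul_smul, mul_comm]
    rw [hdiv, ν.map_mul, hUd]
    conv_lhs => rw [← add_zero (ν (U ^ d))]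
    exact WithTop.add_lt_add_left (ν.ne_top_iff.2 (pow_ne_zero _ hU0)) hpos
  · intro t ht
    rw [hbcoef t ht]
    exact SetLike.coe_mem _
  · have hmonic := (minpoly.monic hint).map (algebraMap A (ResField ν))
    rw [hmonic.as_sum, Polynomial.natDegree_map, hdeg]
    congr 1
    refine Finset.sum_congr rfl fun t ht => ?_
    rw [hbcoef t (Finset.mem_range.1 ht), Polynomial.coeff_map]
    rfl

end NextElement

/-! ### Dependence on finitely many terms -/

section Locality

variable {R K Γ : Type*} [CommRing R] [Field K] [Algebra R K]
  [AddCommGroup Γ] [LinearOrder Γ] [IsOrderedAddMonoid Γ] {ν : AddValuation K (WithTop Γ)}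
  {P P' : ℕ → R} {w w' : ℕ → ℕ → ℕ}

theorem mono_congr {m : ℕ} (hP : ∀ s < m, P s = P' s) (e : ℕ → ℕ) : mono P e m = mono P' e m :=
  Finset.prod_congr rfl fun s hs => by rw [hP s (Finset.mem_range.1 hs)]

theorem valGroup_congr {m : ℕ} (hP : ∀ s < m, P s = P' s) : valGroup ν P m = valGroup ν P' m := by
  rw [valGroup, valGroup]
  congr 1
  ext γ
  constructor
  · rintro ⟨j, hj, hv⟩
    exact ⟨j, hj, by rw [← hP j hj, hv]⟩
  · rintro ⟨j, hj, hv⟩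
    exact ⟨j, hj, by rw [hP j hj, hv]⟩

theorem nbar_congr {i : ℕ} (hP : ∀ s ≤ i, P s = P' s) : nbar ν P i = nbar ν P' i := by
  rw [nbar, nbar, valGroup_congr fun s hs => hP s hs.le,
    valGroup_congr fun s hs => hP s (Nat.le_of_lt_succ hs)]

theorem alpha_congr {i : ℕ} (hP : ∀ s ≤ i, P s = P' s) (hw : w i = w' i) :
    alpha ν P w i = alpha ν P' w' i := by
  rw [alpha, alpha, nbar_congr hP, hP i le_rfl, hw, mono_congr fun s hs => hP s hs.le]

theorem IsValMono.congr {i : ℕ} (hP : ∀ s ≤ i, P s = P' s) (hw : w i = w' i)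
    (hv : IsValMono ν P w i) : IsValMono ν P' w' i := by
  rwa [IsValMono, ← nbar_congr hP, ← hP i le_rfl, ← hw, ← mono_congr fun s hs => hP s hs.le]

variable [IsLocalRing R] {h : Dominates R ν}

theorem adjField_congr {m : ℕ} (hP : ∀ s < m, P s = P' s) (hw : ∀ s < m, w s = w' s) :
    adjField h P w m = adjField h P' w' m := by
  have key : ∀ j < m, alpha ν P w j = alpha ν P' w' j := fun j hj =>
    alpha_congr (fun s hs => hP s (hs.trans_lt hj)) (hw j hj)
  rw [adjField, adjField]
  congr 2
  ext a
  constructor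
  · rintro ⟨j, h1, h2, rfl⟩
    exact ⟨j, h1, h2, key j h2⟩
  · rintro ⟨j, h1, h2, rfl⟩
    exact ⟨j, h1, h2, (key j h2).symm⟩

theorem deg_congr {i : ℕ} (hP : ∀ s ≤ i, P s = P' s) (hw : ∀ s ≤ i, w s = w' s) :
    deg h P w i = deg h P' w' i := by
  rw [deg, deg, adjField_congr (fun s hs => hP s hs.le) fun s hs => hw s hs.le,
    adjField_congr (fun s hs => hP s (Nat.le_of_lt_succ hs)) fun s hs => hw s (Nat.le_of_lt_succ hs)]

theorem bcoef_congr {i : ℕ} (hP : ∀ s ≤ i, P s = P' s) (hw : ∀ s ≤ i, w s = w' s)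
    (lam : ℕ → ℕ) (c : ℕ → ℕ → R) (σ : ℕ → ℕ → ℕ → ℕ) (t : ℕ) :
    bcoef h P lam c σ w i t = bcoef h P' lam c σ w' i t := by
  have hm : ∀ e, mono P e i = mono P' e i := mono_congr fun s hs => hP s hs.le
  rw [bcoef, bcoef, nbar_congr hP, deg_congr hP hw, hw i le_rfl]
  simp only [hm]

theorem map_minpoly_congr {L : Type*} [Field L] {A A' : Subfield L} {a a' : L} (hA : A = A')
    (ha : a = a') :
    (minpoly A a).map (algebraMap A L) = (minpoly A' a').map (algebraMap A' L) := by
  subst hA ha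
  rfl

theorem IsKeySequence.congr {i : ℕ} (hP : ∀ s ≤ i, P s = P' s) (hw : ∀ s < i, w s = w' s)
    (hk : IsKeySequence h P w i) : IsKeySequence h P' w' i where
  ne_zero s hs := hP s hs ▸ hk.ne_zero s hs
  pos s hs := hP s hs ▸ hk.pos s hs
  lt s h1 h2 := by
    have := hk.lt s h1 h2
    rwa [nbar_congr fun j hj => hP j (hj.trans h2.le), deg_congr (fun j hj => hP j (hj.trans h2.le))
      (fun j hj => hw j (hj.trans_lt h2)), hP s h2.le, hP (s + 1) h2] at this
  isValMono s h1 h2 :=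
    (hk.isValMono s h1 h2).congr (fun j hj => hP j (hj.trans h2.le)) (hw s h2)
  finite s h1 h2 := by
    have := hk.finite s h1 h2
    rwa [nbar_congr fun j hj => hP j (hj.trans h2.le), deg_congr (fun j hj => hP j (hj.trans h2.le))
      (fun j hj => hw j (hj.trans_lt h2))] at this

theorem IsNext.congr {CS : Set R} {i : ℕ} {p : R} {lam : ℕ} {c : ℕ → R} {σ : ℕ → ℕ → ℕ}
    (hP : ∀ s ≤ i, P s = P' s) (hw : ∀ s ≤ i, w s = w' s)
    (hn : IsNext h CS P w i p lam c σ) : IsNext h CS P' w' i p lam c σ := by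
  have e1 : ∀ s ≤ i, nbar ν P s = nbar ν P' s := fun s hs =>
    nbar_congr fun j hj => hP j (hj.trans hs)
  have e2 : ∀ s ≤ i, deg h P w s = deg h P' w' s := fun s hs =>
    deg_congr (fun j hj => hP j (hj.trans hs)) fun j hj => hw j (hj.trans hs)
  have e3 : ∀ e, mono P e (i + 1) = mono P' e (i + 1) :=
    mono_congr fun s hs => hP s (Nat.le_of_lt_succ hs)
  have e4 : adjField h P w i = adjField h P' w' i :=
    adjField_congr (fun s hs => hP s hs.le) fun s hs => hw s hs.le
  have e5 := bcoef_congr (h := h) hP hw (fun _ => lam) (fun _ => c) (fun _ => σ)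
  constructor
  · simpa only [e1 i le_rfl, e2 i le_rfl, hP i le_rfl, e3] using hn.eq
  · exact hn.one_le
  · exact hn.mem
  · exact hn.coeff_ne_zero
  · intro k h1 h2 s h3 h4
    rw [← e1 s h4, ← e2 s h4]
    exact hn.exponent_lt k h1 h2 s h3 h4
  · exact hn.exponent_zero_pos
  · rw [← e1 i le_rfl]
    exact hn.dvd
  · simpa only [e1 i le_rfl, e2 i le_rfl, hP i le_rfl, e3] using hn.nu_eq
  · simpa only [e1 i le_rfl, e2 i le_rfl, hP i le_rfl] using hn.nu_lt
  · simpa only [e2 i le_rfl, e4, e5] using hn.bcoef_mem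
  · rw [← map_minpoly_congr e4 (alpha_congr hP (hw i le_rfl)), hn.minpoly_eq, e2 i le_rfl]
    simp only [e5]

end Locality

/-! ### The recursion -/

section Recursion

/-- Recursive construction of a sequence: the condition `Q i` only depends on the terms of index at
most `i`, and it can be satisfied by a choice of the term of index `i`. -/
theorem exists_seq {α : Type*} [Nonempty α] (Q : ℕ → (ℕ → α) → Prop)
    (hcongr : ∀ i f g, (∀ j ≤ i, f j = g j) → Q i f → Q i g)
    (hstep : ∀ i f, (∀ j < i, Q j f) → ∃ a, Q i (Function.update f i a)) :
    ∃ f, ∀ i, Q i f := by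
  classical
  choose! next hnext using hstep
  let F : (i : ℕ) → ((j : ℕ) → j < i → α) → α := fun i r =>
    next i fun j => if hj : j < i then r j hj else Classical.arbitrary α
  let f : ℕ → α := fun i => Nat.strongRec F i
  have hf : ∀ i, f i = next i fun j => if j < i then f j else Classical.arbitrary α := by
    intro i
    simp only [f]
    rw [Nat.strongRec]
    simp only [F]
    congr 1
  refine ⟨f, fun i => ?_⟩
  induction i using Nat.strong_induction_on with
  | _ i ih =>
    have h1 := hnext i (fun j => if j < i then f j else Classical.arbitrary α) fun j hj =>
      hcongr j f _ (fun k hk => (if_pos (hk.trans_lt hj)).symm) (ih j hj)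
    refine hcongr i _ f (fun j hj => ?_) h1
    rcases hj.lt_or_eq with hj | rfl
    · rw [Function.update_of_ne hj.ne, if_pos hj]
    · rw [Function.update_self, ← hf j]

/-- The sequence `a, q_0, q_1, …`. -/
def consSeq {α : Type*} (a : α) (q : ℕ → α) : ℕ → α
  | 0 => a
  | i + 1 => q i

theorem consSeq_congr {α : Type*} {a : α} {q q' : ℕ → α} {i : ℕ} (hq : ∀ j < i, q j = q' j) :
    ∀ s ≤ i, consSeq a q s = consSeq a q' s
  | 0, _ => rfl
  | s + 1, hs => hq s hs

variable {R K Γ : Type*} [CommRing R] [IsLocalRing R] [Field K] [Algebra R K]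
  [AddCommGroup Γ] [LinearOrder Γ] [IsOrderedAddMonoid Γ] {ν : AddValuation K (WithTop Γ)}
  {h : Dominates R ν} {P P' : ℕ → R} {w w' : ℕ → ℕ → ℕ} {CS : Set R}

/-- If `n̄_j` and `d_j` are finite for all `1 ≤ j < i`, then `U_i` has the required properties, and
so has `P_{i+1}` if `n̄_i` and `d_i` are finite as well. -/
def IsStep (h : Dominates R ν) (CS : Set R) (P : ℕ → R) (w : ℕ → ℕ → ℕ) (i : ℕ) : Prop :=
  (∀ j, 1 ≤ j → j < i → nbar ν P j ≠ 0 ∧ deg h P w j ≠ 0) →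
    (nbar ν P i ≠ 0 → ∀ s, 1 ≤ s → s < i → w i s < nbar ν P s * deg h P w s) ∧
    IsValMono ν P w i ∧
    (nbar ν P i ≠ 0 → deg h P w i ≠ 0 → ∃ lam c σ, IsNext h CS P w i (P (i + 1)) lam c σ)

theorem IsStep.congr {i : ℕ} (hP : ∀ s ≤ i + 1, P s = P' s) (hw : ∀ s ≤ i, w s = w' s)
    (hs : IsStep h CS P w i) : IsStep h CS P' w' i := by
  have hP' : ∀ s ≤ i, P s = P' s := fun s hs => hP s (hs.trans (Nat.le_succ i))
  have e1 : ∀ s ≤ i, nbar ν P s = nbar ν P' s := fun s hs =>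
    nbar_congr fun j hj => hP' j (hj.trans hs)
  have e2 : ∀ s ≤ i, deg h P w s = deg h P' w' s := fun s hs =>
    deg_congr (fun j hj => hP' j (hj.trans hs)) fun j hj => hw j (hj.trans hs)
  intro hact
  obtain ⟨h1, h2, h3⟩ := hs fun j a b => by
    rw [e1 j b.le, e2 j b.le]
    exact hact j a b
  refine ⟨fun hn s a b => ?_, h2.congr hP' (hw i le_rfl), fun hn hd => ?_⟩
  · rw [← e1 s b.le, ← e2 s b.le, ← hw i le_rfl]
    exact h1 (by rwa [e1 i le_rfl]) s a b
  · obtain ⟨lam, c, σ, hnext⟩ := h3 (by rwa [e1 i le_rfl]) (by rwa [e2 i le_rfl])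
    refine ⟨lam, c, σ, ?_⟩
    rw [← hP (i + 1) le_rfl]
    exact hnext.congr hP' hw

variable {x y : R}

/-- Modulo `x = P_0`, every `P_s` is a power of `y = P_1`, since all monomials in the expression of
`P_{s+1}` except `P_s^{n_s}` are divisible by `P_0`. Hence no `P_s` vanishes. -/
theorem isKeySequence_of_isStep [FaithfulSMul R K]
    (hy : ∀ N, y ^ N ∉ Ideal.span {x}) (hx0 : x ≠ 0)
    (hxm : x ∈ IsLocalRing.maximalIdeal R) (hym : y ∈ IsLocalRing.maximalIdeal R)
    (hP0 : P 0 = x) (hP1 : P 1 = y) {i : ℕ}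
    (hs : ∀ s, 1 ≤ s → s < i → IsStep h CS P w s)
    (hact : ∀ j, 1 ≤ j → j < i → nbar ν P j ≠ 0 ∧ deg h P w j ≠ 0) :
    IsKeySequence h P w i := by
  have hnext : ∀ s, 1 ≤ s → s < i → ∃ lam c σ, IsNext h CS P w s (P (s + 1)) lam c σ :=
    fun s h1 h2 => (hs s h1 h2 fun j a b => hact j a (b.trans h2)).2.2
      (hact s h1 h2).1 (hact s h1 h2).2
  have hpow : ∀ s, 1 ≤ s → s ≤ i → ∃ N, P s - y ^ N ∈ Ideal.span {x} := by
    intro s hs1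
    induction s, hs1 using Nat.le_induction with
    | base => exact fun _ => ⟨1, by rw [hP1, pow_one, sub_self]; exact Ideal.zero_mem _⟩
    | succ s hs1 ih =>
      intro hsi
      obtain ⟨N, hN⟩ := ih (Nat.le_of_succ_le hsi)
      obtain ⟨lam, c, σ, hn⟩ := hnext s hs1 hsi
      refine ⟨N * (nbar ν P s * deg h P w s), ?_⟩
      rw [hn.eq, add_sub_right_comm, pow_mul y N]
      refine Ideal.add_mem _ (Ideal.mem_of_dvd _ (sub_dvd_pow_sub_pow _ _ _) hN)
        (Ideal.sum_mem _ fun k hk => Ideal.mul_mem_left _ _ ?_)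
      have hpos := hn.exponent_zero_pos k (Finset.mem_Icc.1 hk).1 (Finset.mem_Icc.1 hk).2
      rw [Ideal.mem_span_singleton]
      refine dvd_trans ?_ (Finset.dvd_prod_of_mem _ (Finset.mem_range.2 (Nat.succ_pos s)))
      rw [hP0]
      exact dvd_pow_self _ hpos.ne'
  have hne : ∀ s ≤ i, algebraMap R K (P s) ≠ 0 := by
    intro s hsi
    rw [Ne, FaithfulSMul.algebraMap_eq_zero_iff]
    rcases Nat.eq_zero_or_pos s with rfl | hs0
    · rwa [hP0]
    · intro h0
      obtain ⟨N, hN⟩ := hpow s hs0 hsi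
      rw [h0, zero_sub, Ideal.neg_mem_iff] at hN
      exact hy N hN
  have hnu : ∀ s ≤ i, 0 < ν (algebraMap R K (P s)) := by
    intro s hsi
    rcases s with _ | _ | s
    · rw [hP0]
      exact (h.pos_iff x).2 hxm
    · rw [zero_add, hP1]
      exact (h.pos_iff y).2 hym
    · obtain ⟨lam, c, σ, hn⟩ := hnext (s + 1) (Nat.succ_pos s) hsi
      exact (nsmul_nonneg (h.nonneg _) _).trans_lt hn.nu_lt
  refine ⟨hne, fun s hsi => ?_, fun s h1 h2 => ?_, fun s h1 h2 => ?_, hact⟩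
  · have := hnu s hsi
    rwa [← coe_val (hne s hsi), ← WithTop.coe_zero, WithTop.coe_lt_coe] at this
  · obtain ⟨lam, c, σ, hn⟩ := hnext s h1 h2
    have := hn.nu_lt
    rwa [← ν.map_pow, ← coe_val (pow_ne_zero _ (hne s h2.le)), val_pow (hne s h2.le),
      ← coe_val (hne (s + 1) h2), WithTop.coe_lt_coe] at this
  · exact (hs s h1 h2 fun j a b => hact j a (b.trans h2)).2.1

/-- Only `P` and `w` are constructed recursively: they determine `n̄_i`, `d_i` and so `n_i`, and the
expression of `P_{i+1}` can be chosen afterwards. -/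
theorem exists_forall_isStep [FaithfulSMul R K] (h : Dominates R ν) (hCS : IsCoefficientSet CS)
    (hy : ∀ N, y ^ N ∉ Ideal.span {x}) (hx0 : x ≠ 0)
    (hxm : x ∈ IsLocalRing.maximalIdeal R) (hym : y ∈ IsLocalRing.maximalIdeal R) :
    ∃ (P : ℕ → R) (w : ℕ → ℕ → ℕ), P 0 = x ∧ P 1 = y ∧ ∀ i, 1 ≤ i → IsStep h CS P w i := by
  classical
  -- the term of index `i` of the sequence constructed is `(P_{i+1}, w_i)`
  obtain ⟨f, hf⟩ := exists_seq (α := R × (ℕ → ℕ))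
    (fun i f => (i = 0 → (f 0).1 = y) ∧ (1 ≤ i → IsStep h CS (consSeq x fun j => (f j).1)
      (fun j => (f j).2) i)) (by
      rintro i f g hfg ⟨h1, h2⟩
      refine ⟨fun hi => ?_, fun hi => ?_⟩
      · rw [← hfg 0 (Nat.zero_le i), h1 hi]
      · exact (h2 hi).congr (consSeq_congr fun j hj => by rw [hfg j (Nat.le_of_lt_succ hj)])
          fun j hj => by rw [hfg j hj]) (by
      intro i f hf
      rcases Nat.eq_zero_or_pos i with rfl | hi
      · exact ⟨(y, 0), fun _ => by rw [Function.update_self], fun hi => absurd hi (by omega)⟩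
      set P : ℕ → R := consSeq x fun j => (f j).1 with hP
      set w : ℕ → ℕ → ℕ := fun j => (f j).2 with hw
      have hPa : ∀ a, ∀ s ≤ i, P s = consSeq x (fun j => (Function.update f i a j).1) s := fun a =>
        consSeq_congr fun j hj => by rw [Function.update_of_ne hj.ne]
      have hwa : ∀ a, ∀ s < i, w s = (Function.update f i a s).2 := fun a s hs => by
        rw [Function.update_of_ne hs.ne]
      by_cases hact : ∀ j, 1 ≤ j → j < i → nbar ν P j ≠ 0 ∧ deg h P w j ≠ 0
      · have hk : IsKeySequence h P w i := isKeySequence_of_isStep hy hx0 hxm hym rfl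
          ((hf 0 hi).1 rfl) (fun s h1 h2 => (hf s h2).2 h1) hact
        have hu : ∃ u : ℕ → ℕ, nbar ν P i ≠ 0 →
            (∀ s, 1 ≤ s → s < i → u s < nbar ν P s * deg h P w s) ∧
            ν (algebraMap R K (P i) ^ nbar ν P i) = ν (algebraMap R K (mono P u i)) := by
          by_cases hn : nbar ν P i = 0
          · exact ⟨0, fun hn' => absurd hn hn'⟩
          · obtain ⟨u, hu⟩ := hk.exists_valMono hi hn
            exact ⟨u, fun _ => hu⟩
        obtain ⟨u, hu⟩ := hu
        -- the degree `d_i` depends on the monomial `U_i` just chosen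
        have hwu : ∀ s < i, w s = Function.update w i u s := fun s hs =>
          (Function.update_of_ne hs.ne _ _).symm
        have hk' : IsKeySequence h P (Function.update w i u) i := hk.congr (fun _ _ => rfl) hwu
        have hv : IsValMono ν P (Function.update w i u) i := fun hn => by
          rw [Function.update_self]
          exact (hu hn).2
        have hp : ∃ p, nbar ν P i ≠ 0 → deg h P (Function.update w i u) i ≠ 0 →
            ∃ lam c σ, IsNext h CS P (Function.update w i u) i p lam c σ := by
          by_cases hn : nbar ν P i ≠ 0 ∧ deg h P (Function.update w i u) i ≠ 0
          · obtain ⟨p, hp⟩ := hk'.exists_isNext hi hCS hv hn.1 hn.2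
            exact ⟨p, fun _ _ => hp⟩
          · exact ⟨0, fun h1 h2 => absurd ⟨h1, h2⟩ hn⟩
        obtain ⟨p, hp⟩ := hp
        have hwp : ∀ s ≤ i, Function.update w i u s = (Function.update f i (p, u) s).2 := by
          intro s hs
          rcases hs.lt_or_eq with hs | rfl
          · rw [Function.update_of_ne hs.ne, Function.update_of_ne hs.ne]
          · rw [Function.update_self, Function.update_self]
        refine ⟨(p, u), fun h0 => absurd h0 (by omega), fun _ => ?_⟩
        have hP' := hPa (p, u)
        refine fun _ => ⟨fun hn s h1 h2 => ?_, hv.congr hP' (hwp i le_rfl), fun hn hd => ?_⟩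
        · rw [← nbar_congr fun j hj => hP' j (hj.trans h2.le),
            ← deg_congr (fun j hj => hP' j (hj.trans h2.le))
              (fun j hj => hwa (p, u) j (hj.trans_lt h2))]
          change (Function.update f i (p, u) i).2 s < _
          rw [Function.update_self]
          exact (hu (by rwa [nbar_congr hP'])).1 s h1 h2
        · obtain ⟨lam, c, σ, hn⟩ := hp (by rwa [nbar_congr hP']) (by rwa [deg_congr hP' hwp])
          refine ⟨lam, c, σ, ?_⟩
          have : consSeq x (fun j => (Function.update f i (p, u) j).1) (i + 1) = p := by
            rw [consSeq, Function.update_self]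
          rw [this]
          exact hn.congr hP' hwp
      · refine ⟨(0, 0), fun h0 => absurd h0 (by omega), fun _ hact' => absurd ?_ hact⟩
        intro j h1 h2
        rw [nbar_congr fun s hs => hPa (0, 0) s (hs.trans h2.le),
          deg_congr (fun s hs => hPa (0, 0) s (hs.trans h2.le))
            fun s hs => hwa (0, 0) s (hs.trans_lt h2)]
        exact hact' j h1 h2)
  exact ⟨consSeq x fun j => (f j).1, fun j => (f j).2, rfl, (hf 0).1 rfl, fun i => (hf i).2⟩

end Recursion

/-! ### The length of the sequence and the regular parameters -/

/-- The index at which a sequence has to end if it ends at the first `i ≥ 1` with `¬p i`. -/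
theorem exists_first_failure (p : ℕ → Prop) :
    ∃ Ω : ℕ∞, 1 ≤ Ω ∧ ∀ i : ℕ, 1 ≤ i → (i : ℕ∞) ≤ Ω → ((i : ℕ∞) = Ω ↔ ¬p i) := by
  classical
  by_cases hex : ∃ i, 1 ≤ i ∧ ¬p i
  · obtain ⟨h1, h2⟩ := Nat.find_spec hex
    refine ⟨(Nat.find hex : ℕ), by exact_mod_cast h1, fun i hi hle => ?_⟩
    rw [Nat.cast_inj]
    constructor
    · rintro rfl
      exact h2
    · intro hn
      exact le_antisymm (by exact_mod_cast hle) (Nat.find_min' hex ⟨hi, hn⟩)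
  · push Not at hex
    exact ⟨⊤, le_top, fun i hi _ => ⟨fun h => absurd h (ENat.natCast_ne_top i), fun h => absurd (hex i hi) h⟩⟩

/-- In dimension two the maximal ideal `(x, y)` is not minimal over `(x)`, by Krull's principal
ideal theorem. -/
theorem pow_notMem_span_of_ringKrullDim {R : Type*} [CommRing R] [IsLocalRing R] [IsNoetherianRing R]
    (hdim : ringKrullDim R = 2) {x y : R}
    (hxy : IsLocalRing.maximalIdeal R = Ideal.span {x, y}) (N : ℕ) : y ^ N ∉ Ideal.span {x} := by
  intro hN
  have hmin : IsLocalRing.maximalIdeal R ∈ (Ideal.span {x}).minimalPrimes := by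
    refine ⟨⟨inferInstance, ?_⟩, ?_⟩
    · rw [hxy]
      exact Ideal.span_mono (by simp)
    · rintro q ⟨hq, hxq⟩ -
      rw [hxy, Ideal.span_le, Set.insert_subset_iff, Set.singleton_subset_iff]
      exact ⟨hxq (Ideal.mem_span_singleton_self x), hq.mem_of_pow_mem N (hxq hN)⟩
  have h1 := Ideal.height_le_one_of_isPrincipal_of_mem_minimalPrimes _ _ hmin
  have h2 := IsLocalRing.maximalIdeal_height_eq_ringKrullDim (R := R)
  rw [hdim] at h2
  have h3 : (IsLocalRing.maximalIdeal R).height = 2 := WithBot.coe_injective h2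
  rw [h3] at h1
  exact absurd h1 (by decide)

end KeyPoly

end

theorem theorem4p2 {R K Γ : Type*} [CommRing R] [IsRegularLocalRing R]
    (hdim : ringKrullDim R = 2)
    [Field K] [Algebra R K] [IsFractionRing R K]
    [AddCommGroup Γ] [LinearOrder Γ] [IsOrderedAddMonoid Γ]
    (CS : Set R) (hCS : KeyPoly.IsCoefficientSet CS)
    (ν : AddValuation K (WithTop Γ)) (hν : KeyPoly.Dominates R ν)
    (x y : R) (hxy : IsLocalRing.maximalIdeal R = Ideal.span {x, y}) :
    ∃ (Ω : ℕ∞) (P : ℕ → R) (n lam : ℕ → ℕ) (c : ℕ → ℕ → R) (σ : ℕ → ℕ → ℕ → ℕ) (w : ℕ → ℕ → ℕ),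
      1 ≤ Ω ∧
      (∀ i : ℕ, (i : ℕ∞) ≤ Ω → P i ∈ IsLocalRing.maximalIdeal R) ∧
      P 0 = x ∧ P 1 = y ∧
      -- the expression of `P_{i+1}`
      (∀ i : ℕ, 1 ≤ i → (i : ℕ∞) < Ω →
        P (i + 1) = P i ^ n i +
          ∑ k ∈ Finset.Icc 1 (lam i), c i k * KeyPoly.mono P (σ i k) (i + 1) ∧
        1 ≤ n i ∧ 1 ≤ lam i ∧
        ∀ k, 1 ≤ k → k ≤ lam i →
          c i k ∈ CS ∧ c i k ≠ 0 ∧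
          (∀ s, 1 ≤ s → s ≤ i → σ i k s < n s) ∧
          n i • ν (algebraMap R K (P i)) =
            ν (algebraMap R K (KeyPoly.mono P (σ i k) (i + 1)))) ∧
      -- 1)
      (∀ i : ℕ, 1 ≤ i → (i : ℕ∞) < Ω →
        n i • ν (algebraMap R K (P i)) < ν (algebraMap R K (P (i + 1)))) ∧
      -- 2), where no bound is imposed on the exponent of `P_Ω`
      (∀ r : ℕ, (r : ℕ∞) ≤ Ω → ∀ (m : ℕ) (j : Fin (m + 1) → ℕ → ℕ),
        (∀ l k, 1 ≤ k → k ≤ r → (k : ℕ∞) < Ω → j l k < n k) →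
        (∀ l l', l ≠ l' → ∃ k ≤ r, j l k ≠ j l' k) →
        (∀ l, ν (algebraMap R K (KeyPoly.mono P (j l) (r + 1))) =
          ν (algebraMap R K (KeyPoly.mono P (j 0) (r + 1)))) →
        LinearIndependent (KeyPoly.baseField hν) (fun l =>
          KeyPoly.res ν (algebraMap R K (KeyPoly.mono P (j l) (r + 1)) /
            algebraMap R K (KeyPoly.mono P (j 0) (r + 1))))) ∧
      -- 3)
      (∀ i : ℕ, 1 ≤ i → (i : ℕ∞) < Ω →
        (∀ k, 1 ≤ k → k ≤ lam i → KeyPoly.nbar ν P i ∣ σ i k i) ∧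
        n i = KeyPoly.nbar ν P i * KeyPoly.deg hν P w i ∧
        0 < KeyPoly.nbar ν P i ∧ 0 < KeyPoly.deg hν P w i) ∧
      -- 4), the monomials `U_i` (also for `i = Ω`, if the index there is finite)
      (∀ i : ℕ, 1 ≤ i → (i : ℕ∞) ≤ Ω → KeyPoly.nbar ν P i ≠ 0 →
        (∀ s, 1 ≤ s → s < i → w i s < n s) ∧
        ν (algebraMap R K (P i) ^ KeyPoly.nbar ν P i) =
          ν (algebraMap R K (KeyPoly.mono P (w i) i))) ∧
      -- 4), the minimal polynomial of `α_i` over `k(α_1, …, α_{i-1})`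
      (∀ i : ℕ, 1 ≤ i → (i : ℕ∞) < Ω →
        (∀ t < KeyPoly.deg hν P w i,
          KeyPoly.bcoef hν P lam c σ w i t ∈ KeyPoly.adjField hν P w i) ∧
        (minpoly (KeyPoly.adjField hν P w i) (KeyPoly.alpha ν P w i)).map
            (algebraMap (KeyPoly.adjField hν P w i) (KeyPoly.ResField ν)) =
          Polynomial.X ^ KeyPoly.deg hν P w i +
            ∑ t ∈ Finset.range (KeyPoly.deg hν P w i),
              Polynomial.C (KeyPoly.bcoef hν P lam c σ w i t) * Polynomial.X ^ t) ∧
      -- the sequence ends with `P_i` if and only if `n̄_i = ∞`, or `n̄_i < ∞` and `d_i = ∞`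
      (∀ i : ℕ, 1 ≤ i → (i : ℕ∞) ≤ Ω →
        ((i : ℕ∞) = Ω ↔ (KeyPoly.nbar ν P i = 0 ∨
          (KeyPoly.nbar ν P i ≠ 0 ∧ KeyPoly.deg hν P w i = 0)))) := by
  have hxm : x ∈ IsLocalRing.maximalIdeal R := hxy ▸ Ideal.subset_span (by simp)
  have hym : y ∈ IsLocalRing.maximalIdeal R := hxy ▸ Ideal.subset_span (by simp)
  have hy := KeyPoly.pow_notMem_span_of_ringKrullDim hdim hxy
  have hx0 : x ≠ 0 := by
    rintro rfl
    exact KeyPoly.pow_notMem_span_of_ringKrullDim (x := y) (y := 0) hdim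
      (hxy.trans (by rw [Set.pair_comm])) 1 (by rw [pow_one]; exact Ideal.zero_mem _)
  obtain ⟨P, w, hP0, hP1, hstep⟩ := KeyPoly.exists_forall_isStep hν hCS hy hx0 hxm hym
  obtain ⟨Ω, hΩ1, hΩ⟩ := KeyPoly.exists_first_failure fun i =>
    KeyPoly.nbar ν P i ≠ 0 ∧ KeyPoly.deg hν P w i ≠ 0
  have hfin : ∀ i : ℕ, 1 ≤ i → (i : ℕ∞) < Ω →
      KeyPoly.nbar ν P i ≠ 0 ∧ KeyPoly.deg hν P w i ≠ 0 := fun i hi hlt =>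
    not_not.1 fun hn => hlt.ne ((hΩ i hi hlt.le).2 hn)
  have hcoe : ∀ {i j : ℕ}, j < i → (i : ℕ∞) ≤ Ω → (j : ℕ∞) < Ω := fun hji hi =>
    (Nat.cast_lt.2 hji).trans_le hi
  have hchain : ∀ i : ℕ, (i : ℕ∞) ≤ Ω → KeyPoly.IsKeySequence hν P w i := fun i hi =>
    KeyPoly.isKeySequence_of_isStep hy hx0 hxm hym hP0 hP1 (fun s h1 _ => hstep s h1)
      fun j h1 h2 => hfin j h1 (hcoe h2 hi)
  have hstep' := fun (i : ℕ) (hi : 1 ≤ i) (hle : (i : ℕ∞) ≤ Ω) =>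
    hstep i hi fun j h1 h2 => hfin j h1 (hcoe h2 hle)
  have hnext : ∀ i : ℕ, 1 ≤ i → (i : ℕ∞) < Ω →
      ∃ lam c σ, KeyPoly.IsNext hν CS P w i (P (i + 1)) lam c σ := fun i hi hlt =>
    (hstep' i hi hlt.le).2.2 (hfin i hi hlt).1 (hfin i hi hlt).2
  choose! lam c σ hnext using hnext
  refine ⟨Ω, P, fun i => KeyPoly.nbar ν P i * KeyPoly.deg hν P w i, lam, c, σ, w, hΩ1, ?_, hP0, hP1,
    ?_, ?_, ?_, ?_, ?_, ?_, ?_⟩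
  · intro i hi
    rw [← hν.pos_iff, ← KeyPoly.coe_val ((hchain i hi).ne_zero i le_rfl), ← WithTop.coe_zero,
      WithTop.coe_lt_coe]
    exact (hchain i hi).pos i le_rfl
  · intro i hi hlt
    have hn := hnext i hi hlt
    exact ⟨hn.eq, Nat.pos_of_ne_zero (mul_ne_zero (hfin i hi hlt).1 (hfin i hi hlt).2), hn.one_le,
      fun k h1 h2 => ⟨hn.mem k h1 h2, hn.coeff_ne_zero k h1 h2, hn.exponent_lt k h1 h2,
        hn.nu_eq k h1 h2⟩⟩
  · exact fun i hi hlt => (hnext i hi hlt).nu_lt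
  · intro r hr m j hj hinj hv
    have hk := hchain r hr
    simp only [KeyPoly.algebraMap_mono] at hv ⊢
    refine KeyPoly.linearIndependent_res_lmono hν (Nat.succ_pos r)
      (fun s hs => hk.ne_zero s (Nat.le_of_lt_succ hs)) (hk.pos 0 (Nat.zero_le r))
      (fun s h1 h2 => (hstep' s h1 ((Nat.cast_le.2 (Nat.le_of_lt_succ h2)).trans hr)).2.1)
      (fun l s => (j l s : ℤ)) (fun l s _ _ => Int.natCast_nonneg _) (fun l s h1 h2 hn hd => ?_)
      (fun l l' hll => ?_) _ hv
    · have hs : (s : ℕ∞) ≤ Ω := (Nat.cast_le.2 (Nat.le_of_lt_succ h2)).trans hr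
      have hlt : (s : ℕ∞) < Ω := lt_of_le_of_ne hs fun h0 => (hΩ s h1 hs).1 h0 ⟨hn, hd⟩
      exact Int.ofNat_lt.2 (hj l s h1 (Nat.le_of_lt_succ h2) hlt)
    · by_contra hne
      obtain ⟨k, hk, hjk⟩ := hinj l l' hne
      exact hjk (Int.ofNat_inj.1 (hll k (Nat.lt_succ_of_le hk)))
  · exact fun i hi hlt => ⟨(hnext i hi hlt).dvd, rfl, Nat.pos_of_ne_zero (hfin i hi hlt).1,
      Nat.pos_of_ne_zero (hfin i hi hlt).2⟩
  · exact fun i hi hle hn => ⟨(hstep' i hi hle).1 hn, (hstep' i hi hle).2.1 hn⟩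
  · exact fun i hi hlt => ⟨(hnext i hi hlt).bcoef_mem, (hnext i hi hlt).minpoly_eq⟩
  · intro i hi hle
    rw [hΩ i hi hle]
    tauto
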